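/- Let $d,r\ge 1$, let $\mathcal U_d$ be the group of complex $d$th roots of unity with generator $\zeta$, and let $G=G(d,1,r)=\mathcal U_d^r\rtimes\mathfrak S_r$, where $\sigma^{-1}(z_1,\dots,z_r)\sigma=(z_{\sigma(1)},\dots,z_{\sigma(r)})$. Put $t=(\zeta,1,\dots,1)$ and $s_i=(i\ \,i{+}1)\in\mathfrak S_r$. Let $\underline\lambda=(\lambda^{(0)},\dots,\lambda^{(d-1)})$ be a $d$-multipartition of $r$; write $c_i=|\lambda^{(i)}|$, $C_i=c_0+\dots+c_{i-1}$, $E_i=\{C_i+1,\dots,C_i+c_i\}$, and let $\mathfrak S_c\cong\prod_i\mathfrak S_{c_i}$ be the subgroup of $\mathfrak S_r$ preserving every $E_i$, and $G_c=\mathcal U_d^r\rtimes\mathfrak S_c$. For boxes of a diagram, the diagonal of the box in row $u$ and column $v$ is $v-u$; for entries $x,y$ of a tableau, $a(x,y)$ is the diagonal of $y$ minus the diagonal of $x$. For a partition $\lambda$ of $k$, let $V_\lambda$ be the irreducible representation of $\mathfrak S_k$ labelled by $\lambda$ (the complex Specht module) in Young's seminormal form: it has a basis $v_{\lambda,T}$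 indexed by the standard tableaux $T$ of shape $\lambda$, and $s_i v_{\lambda,T}=\frac1{a(i,i+1)}v_{\lambda,T}+\bigl(1+\frac1{a(i,i+1)}\bigr)v_{\lambda,T_{i\leftrightarrow i+1}}$ for $1\le i<k$. Here $T_{i\leftrightarrow i+1}$ is obtained by exchanging $i$ and $i+1$, and $v_{\lambda,T_{i\leftrightarrow i+1}}=0$ if it is not standard. *James--Kerber model.* Let $\mathfrak S_c$ act on $V_{\underline\lambda}=V_{\lambda^{(0)}}\otimes\dots\otimes V_{\lambda^{(d-1)}}$ factor by factor, and let $z\in\mathcal U_d^r$ act on it by the scalar $\prod_i\prod_{x\in E_i}z_x^{\,i}$. Put $W_{\underline\lambda}=\operatorname{Ind}_{G_c}^G V_{\underline\lambda}=\mathbb C[G]\otimes_{\mathbb C[G_c]}V_{\underline\lambda}$. *Marin--Michel model.* Let $W'_{\underline\lambda}$ be the complex vector space with basis the standard multitableaux $\underline T=(T_0,\dots,T_{d-1})$ of shape $\underline\lambda$ (each of $1,\dots,r$ occurs exactly once, and each $T_i$ increases along rows and columns). There is a unique $G$-module structure on $W'_{\underline\lambda}$ such that $t\,\underline T=\zeta^{m}\underline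 T$ if $1$ lies in $T_m$, and, for $1\le i<r$, $s_i\underline T=\underline T_{i\leftrightarrow i+1}$ if $i,i+1$ lie in different components, and $s_i\underline T=\frac1{a(i,i+1)}\underline T+\bigl(1+\frac1{a(i,i+1)}\bigr)\underline T_{i\leftrightarrow i+1}$ if they lie in the same component (where $\underline T_{i\leftrightarrow i+1}$ is read as $0$ if it is not standard). With this structure, the linear map $f_{\underline\lambda}:W'_{\underline\lambda}\to W_{\underline\lambda}$ given on the basis by $$f_{\underline\lambda}(T_0,\dots,T_{d-1})=t_X\otimes v_{\lambda^{(0)},\theta(T_0)}\otimes\dots\otimes v_{\lambda^{(d-1)},\theta(T_{d-1})}$$ is an isomorphism of $G$-modules. Here $X=(X_0,\dots,X_{d-1})$ with $X_i$ the set of entries of $T_i$; $t_X\in\mathfrak S_r$ sends $C_i+j$ to the $j$th smallest element of $X_i$; and $\theta(T_i)$ is the standard tableau obtained from $T_i$ by replacing its $j$th smallest entry by $j$. -/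

import Mathlib

/-! ### Standard tableaux and the symmetric group -/

namespace GdOneR

open Equiv Finset

/-- A filling `f` of the boxes `(row, column)` of `μ` is increasing along rows and columns. -/
def IsStd (μ : YoungDiagram) {α : Type*} [LT α] (f : μ.cells → α) : Prop :=
  (∀ p q : μ.cells, p.1.1 = q.1.1 → p.1.2 < q.1.2 → f p < f q) ∧
  (∀ p q : μ.cells, p.1.2 = q.1.2 → p.1.1 < q.1.1 → f p < f q)

/-- Standard tableaux of shape `μ` with respect to a (linearly) ordered set `α` of entries, each
element of `α` being used exactly once; `StdTableau μ (Fin μ.card)` is the set `ST(μ)` of usual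
standard tableaux (entries counted from `0`). -/
@[ext] structure StdTableau (μ : YoungDiagram) (α : Type*) [LT α] where
  /-- the entry in each box -/
  entry : μ.cells ≃ α
  std : IsStd μ entry

/-- The diagonal on which a box lies: column minus row. -/
def content (p : ℕ × ℕ) : ℤ := (p.2 : ℤ) - p.1

/-- The axial distance `a(x, y)`: from the diagonal of the entry `x` to the diagonal of `y`. -/
def StdTableau.axialDist {μ : YoungDiagram} {α : Type*} [LT α] (T : StdTableau μ α) (x y : α) :
    ℤ :=
  content (T.entry.symm y).1 - content (T.entry.symm x).1

open Classical in
/-- The basis vector of the tableau obtained from `T` by exchanging the entries `x` and `y`,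
read as `0` when the resulting filling is not standard. -/
noncomputable def StdTableau.swapVec {μ : YoungDiagram} {α : Type*} [LT α] [DecidableEq α]
    (T : StdTableau μ α) (x y : α) : StdTableau μ α →₀ ℂ :=
  if h : IsStd μ (T.entry.trans (swap x y)) then Finsupp.single ⟨T.entry.trans (swap x y), h⟩ 1
  else 0

/-- Young's seminormal formula for the action of the simple transpositions
`s = (x x+1)` on the vectors `v_T`. -/
def IsSeminormal (μ : YoungDiagram)
    (ψ : Representation ℂ (Perm (Fin μ.card)) (StdTableau μ (Fin μ.card) →₀ ℂ)) : Prop :=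
  ∀ (T : StdTableau μ (Fin μ.card)) (x y : Fin μ.card), (x : ℕ) + 1 = y →
    ψ (swap x y) (Finsupp.single T 1) =
      (1 / (T.axialDist x y : ℂ)) • Finsupp.single T 1 +
        (1 + 1 / (T.axialDist x y : ℂ)) • T.swapVec x y

end GdOneR
namespace GdOneR
open Equiv Finset

/-- The product `A (j-1) ⋯ A (m+1) A m` (empty if `j ≤ m`). -/
def descProd {M : Type*} [Monoid M] (A : ℕ → M) (m : ℕ) : ℕ → M
  | 0 => 1
  | j + 1 => if m ≤ j then A j * descProd A m j else 1

/-- The Coxeter relations of the symmetric group on `n` letters. -/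
structure CoxRel {M : Type*} [Monoid M] (A : ℕ → M) (n : ℕ) : Prop where
  sq : ∀ i, i + 1 < n → A i * A i = 1
  comm : ∀ i j, i + 1 < j → j + 1 < n → A i * A j = A j * A i
  braid : ∀ i, i + 2 < n → A i * A (i + 1) * A i = A (i + 1) * A i * A (i + 1)

theorem descProd_self {M : Type*} [Monoid M] (A : ℕ → M) (m : ℕ) : descProd A m m = 1 := by
  cases m <;> simp [descProd]

theorem descProd_succ {M : Type*} [Monoid M] (A : ℕ → M) {m j : ℕ} (h : m ≤ j) :
    descProd A m (j + 1) = A j * descProd A m j := by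
  simp [descProd, h]

theorem CoxRel.descProd_comm {M : Type*} [Monoid M] {A : ℕ → M} {n : ℕ} (h : CoxRel A n)
    {m j i : ℕ} (hj : m ≤ j) (hi : j < i) (hn : i + 1 < n) :
    A i * descProd A m j = descProd A m j * A i := by
  induction j, hj using Nat.le_induction with
  | base => simp [descProd_self]
  | succ j hj ih =>
    rw [descProd_succ A hj, ← mul_assoc, ← h.comm j i hi hn, mul_assoc, ih (by omega), mul_assoc]

theorem CoxRel.descProd_shift {M : Type*} [Monoid M] {A : ℕ → M} {n : ℕ} (h : CoxRel A n)
    {m j i : ℕ} (hm : m ≤ i) (hi : i + 2 ≤ j) (hn : j < n) :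
    A i * descProd A m j = descProd A m j * A (i + 1) := by
  induction j, hi using Nat.le_induction with
  | base =>
    rw [descProd_succ A (by omega : m ≤ i + 1), descProd_succ A hm]
    have hc := h.descProd_comm hm (by omega : i < i + 1) (by omega)
    calc A i * (A (i + 1) * (A i * descProd A m i))
        = (A i * A (i + 1) * A i) * descProd A m i := by simp only [mul_assoc]
      _ = A (i + 1) * A i * (A (i + 1) * descProd A m i) := by
          rw [h.braid i (by omega)]; simp only [mul_assoc]
      _ = _ := by rw [hc]; simp only [mul_assoc]
  | succ j hj ih =>
    rw [descProd_succ A (by omega : m ≤ j), ← mul_assoc, h.comm i j (by omega) hn, mul_assoc,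
      ih (by omega), mul_assoc]

/-- The simple transposition of two consecutive natural numbers. -/
def natSwap (i : ℕ) : Perm ℕ := swap i (i + 1)

theorem natSwap_of_ne {i x : ℕ} (h1 : x ≠ i) (h2 : x ≠ i + 1) : natSwap i x = x :=
  swap_apply_of_ne_of_ne h1 h2

theorem coxRel_natSwap (n : ℕ) : CoxRel natSwap n where
  sq i _ := by simp [natSwap]
  comm i j h _ := by
    ext x
    simp only [natSwap, Perm.mul_apply, swap_apply_def]
    split_ifs <;> omega
  braid i _ := by
    ext x
    simp only [natSwap, Perm.mul_apply, swap_apply_def]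
    split_ifs <;> omega

theorem descProd_natSwap_apply {m j : ℕ} (h : m ≤ j) : descProd natSwap m j m = j := by
  induction j, h using Nat.le_induction with
  | base => simp [descProd_self]
  | succ j hj ih => rw [descProd_succ _ hj, Perm.mul_apply, ih]; simp [natSwap]

theorem descProd_natSwap_fix {m j x : ℕ} (h : m ≤ j) (hx : x < m ∨ j < x) :
    descProd natSwap m j x = x := by
  induction j, h using Nat.le_induction with
  | base => simp [descProd_self]
  | succ j hj ih =>
    rw [descProd_succ _ hj, Perm.mul_apply, ih (by omega), natSwap_of_ne] <;> omega

theorem exists_word_map {M : Type*} [Monoid M] {A : ℕ → M} {n : ℕ} (h : CoxRel A n) (k : ℕ) :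
    ∀ m, m + k = n → ∃ φ : Perm ℕ → M, φ 1 = 1 ∧ ∀ (σ : Perm ℕ),
      (∀ x, x < m ∨ n ≤ x → σ x = x) → ∀ i, m ≤ i → i + 1 < n →
        φ (natSwap i * σ) = A i * φ σ := by
  induction k with
  | zero => intro m hm; exact ⟨fun _ => 1, rfl, fun σ _ i h1 h2 => by omega⟩
  | succ k ih =>
    intro m hm
    obtain ⟨φ, h1, hφ⟩ := ih (m + 1) (by omega)
    have hS := coxRel_natSwap n
    refine ⟨fun σ => descProd A m (σ m) * φ ((descProd natSwap m (σ m))⁻¹ * σ), ?_, ?_⟩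
    · simp [descProd_self, h1]
    intro σ hσ i hi hin
    obtain ⟨j, hj⟩ : ∃ j, σ m = j := ⟨_, rfl⟩
    have hmj : m ≤ j := by
      by_contra hlt
      have h3 := hσ j (Or.inl (by omega))
      rw [← hj] at h3
      have := σ.injective h3
      omega
    have hjn : j < n := by
      by_contra hlt
      have h3 := hσ j (Or.inr (by omega))
      rw [← hj] at h3
      have := σ.injective h3
      omega
    have hτ : ∀ x, x < m + 1 ∨ n ≤ x → ((descProd natSwap m j)⁻¹ * σ) x = x := by
      intro x hx
      rw [Perm.mul_apply, Perm.inv_eq_iff_eq]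
      rcases Nat.lt_or_ge x m with hxm | hxm
      · rw [hσ x (Or.inl hxm), descProd_natSwap_fix hmj (Or.inl hxm)]
      · rcases hx with hx | hx
        · obtain rfl : x = m := by omega
          rw [hj, descProd_natSwap_apply hmj]
        · rw [hσ x (Or.inr hx), descProd_natSwap_fix hmj (Or.inr (by omega))]
    simp only [Perm.mul_apply, hj]
    rcases lt_trichotomy i j with hij | rfl | hij
    · rcases Nat.lt_or_ge (i + 1) j with hij' | hij'
      · rw [natSwap_of_ne (by omega) (by omega)]
        have e1 : (descProd natSwap m j)⁻¹ * (natSwap i * σ) =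
            natSwap (i + 1) * ((descProd natSwap m j)⁻¹ * σ) := by
          rw [← mul_assoc, ← mul_assoc]
          congr 1
          rw [inv_mul_eq_iff_eq_mul, ← mul_assoc, ← hS.descProd_shift hi hij' hjn, mul_assoc,
            mul_inv_cancel, mul_one]
        rw [e1, hφ _ hτ (i + 1) (by omega) (by omega), ← mul_assoc, ← mul_assoc,
          h.descProd_shift hi hij' hjn]
      · obtain rfl : j = i + 1 := by omega
        have e0 : natSwap i (i + 1) = i := by simp [natSwap]
        rw [e0]
        have e1 : (descProd natSwap m (i + 1))⁻¹ * σ =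
            (descProd natSwap m i)⁻¹ * (natSwap i * σ) := by
          rw [descProd_succ _ hi, mul_inv_rev, mul_assoc]
          simp [natSwap]
        rw [e1, descProd_succ A hi, ← mul_assoc (A i), ← mul_assoc (A i), h.sq i hin, one_mul]
    · have e0 : natSwap i i = i + 1 := by simp [natSwap]
      rw [e0]
      have e1 : (descProd natSwap m (i + 1))⁻¹ * (natSwap i * σ) =
          (descProd natSwap m i)⁻¹ * σ := by
        rw [descProd_succ _ hi, mul_inv_rev, mul_assoc]
        simp [natSwap]
      rw [e1, descProd_succ A hi, mul_assoc]
    · rw [natSwap_of_ne (by omega) (by omega)]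
      have e1 : (descProd natSwap m j)⁻¹ * (natSwap i * σ) =
          natSwap i * ((descProd natSwap m j)⁻¹ * σ) := by
        rw [← mul_assoc, ← mul_assoc]
        congr 1
        rw [inv_mul_eq_iff_eq_mul, ← mul_assoc, ← hS.descProd_comm hmj hij hin, mul_assoc,
          mul_inv_cancel, mul_one]
      rw [e1, hφ _ hτ i (by omega) hin, ← mul_assoc, ← mul_assoc, h.descProd_comm hmj hij hin]

/-- A family satisfying the Coxeter relations extends to the symmetric group. -/
theorem CoxRel.exists_hom {M : Type*} [Monoid M] {A : ℕ → M} {n : ℕ} (h : CoxRel A n) :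
    ∃ φ : Perm (Fin n) →* M, ∀ x y : Fin n, (x : ℕ) + 1 = y → φ (swap x y) = A x := by
  obtain ⟨φ, h1, hφ⟩ := exists_word_map h n 0 (by omega)
  let E : Perm (Fin n) →* Perm ℕ := Perm.extendDomainHom Fin.equivSubtype
  have hE : ∀ x y : Fin n, (x : ℕ) + 1 = y → E (swap x y) = natSwap x := by
    intro x y hxy
    ext z
    by_cases hz : z < n
    · have := Perm.extendDomain_apply_image (swap x y) (Fin.equivSubtype (n := n)) ⟨z, hz⟩
      simp only [Fin.equivSubtype_apply] at this
      simp only [E, Perm.extendDomainHom_apply, natSwap]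
      rw [this, swap_apply_def, swap_apply_def]
      simp only [Fin.ext_iff]
      split_ifs <;> (try dsimp only at *) <;> omega
    · simp only [E, Perm.extendDomainHom_apply]
      rw [Perm.extendDomain_apply_not_subtype (swap x y) Fin.equivSubtype hz, natSwap_of_ne] <;>
        omega
  have hfix : ∀ σ : Perm (Fin n), ∀ x, x < 0 ∨ n ≤ x → E σ x = x := by
    intro σ x hx
    simp only [E, Perm.extendDomainHom_apply]
    rw [Perm.extendDomain_apply_not_subtype]
    omega
  have key : ∀ (x y : Fin n), (x : ℕ) + 1 = y → ∀ σ,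
      φ (E (swap x y * σ)) = A x * φ (E σ) := by
    intro x y hxy σ
    rw [map_mul, hE x y hxy]
    exact hφ _ (hfix σ) x (by omega) (by omega)
  have hmul : ∀ σ τ : Perm (Fin n), φ (E (σ * τ)) = φ (E σ) * φ (E τ) := by
    intro σ τ
    rcases n with _ | n
    · have : σ = 1 := Subsingleton.elim _ _
      subst this
      simp [h1]
    have hmem : σ ∈ Submonoid.closure
        (Set.range fun i : Fin n => swap i.castSucc i.succ) := by
      rw [Perm.mclosure_swap_castSucc_succ]; trivial
    induction hmem using Submonoid.closure_induction_left with
    | one => simp [h1]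
    | mul_left g hg σ' _ ih =>
      obtain ⟨i, rfl⟩ := hg
      rw [mul_assoc, key _ _ (by simp), key _ _ (by simp), ih, mul_assoc]
  refine ⟨⟨⟨fun σ => φ (E σ), by simp [h1]⟩, hmul⟩, fun x y hxy => ?_⟩
  have := key x y hxy 1
  simpa [h1] using this
end GdOneR

/-! ### Existence of Young's seminormal representations -/

namespace GdOneR

open Equiv Finset

section Seminormal

theorem braid_aux {V : Type*} [AddCommGroup V] [Module ℂ V] (f g : Module.End ℂ V)
    {v v1 v2 v21 v12 v' : V} {A B C p p' q q' w w2 l l2 : ℂ}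
    (h1 : f v = A • v + p • v1) (h2 : g v = B • v + q • v2)
    (h3 : f v1 = -A • v1 + p' • v) (h4 : g v2 = -B • v2 + q' • v)
    (h5 : g v1 = C • v1 + w • v21) (h6 : f v2 = C • v2 + w2 • v12)
    (h7 : f v21 = B • v21 + l • v') (h8 : g v12 = A • v12 + l2 • v')
    (hp : p * p' = 1 - A ^ 2) (hq : q * q' = 1 - B ^ 2) (hC : A * B = C * (A + B))
    (hl : (p * w * l) • v' = (q * w2 * l2) • v') :
    f (g (f v)) = g (f (g v)) := by
  simp only [h1, h2, h3, h4, h5, h6, h7, h8, map_add, map_smul]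
  linear_combination (norm := module) hl + ((A - B) * hC + C * hp - C * hq) • v
    + (p * hC) • v1 - (q * hC) • v2

theorem comm_aux {V : Type*} [AddCommGroup V] [Module ℂ V] (f g : Module.End ℂ V)
    {v v1 v2 v' : V} {A B p q w w2 : ℂ}
    (h1 : f v = A • v + p • v1) (h2 : g v = B • v + q • v2)
    (h5 : g v1 = B • v1 + w • v') (h6 : f v2 = A • v2 + w2 • v')
    (hl : (p * w) • v' = (q * w2) • v') :
    f (g v) = g (f v) := by
  simp only [h1, h2, h5, h6, map_add, map_smul]
  linear_combination (norm := module) -hl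

variable {μ : YoungDiagram} {n : ℕ}

open Classical in
/-- The basis vector of a filling, or `0` if the filling is not standard. -/
noncomputable def fillVec (e : μ.cells ≃ Fin n) : StdTableau μ (Fin n) →₀ ℂ :=
  if h : IsStd μ e then Finsupp.single ⟨e, h⟩ 1 else 0

/-- The inverse axial distance in a filling. -/
noncomputable def invDist (e : μ.cells ≃ Fin n) (x y : Fin n) : ℂ :=
  1 / ((content (e.symm y).1 - content (e.symm x).1 : ℤ) : ℂ)

open Classical in
/-- The off-diagonal coefficient in the seminormal formula, for arbitrary fillings. -/
noncomputable def offCoeff (e : μ.cells ≃ Fin n) (x y : Fin n) : ℂ :=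
  if IsStd μ e ∧ IsStd μ (e.trans (swap x y)) then 1 + invDist e x y else 0

/-- The linear operator given by the seminormal formula for the transposition `(x y)`. -/
noncomputable def semiOp (x y : Fin n) : Module.End ℂ (StdTableau μ (Fin n) →₀ ℂ) :=
  Finsupp.linearCombination ℂ fun T => (1 / (T.axialDist x y : ℂ)) • Finsupp.single T 1 +
    (1 + 1 / (T.axialDist x y : ℂ)) • T.swapVec x y

theorem semiOp_fillVec (e : μ.cells ≃ Fin n) (x y : Fin n) :
    semiOp x y (fillVec e) =
      invDist e x y • fillVec e + offCoeff e x y • fillVec (e.trans (swap x y)) := by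
  by_cases h : IsStd μ e
  · have h0 : fillVec e = Finsupp.single (⟨e, h⟩ : StdTableau μ (Fin n)) 1 := dif_pos h
    have h1 : semiOp x y (fillVec e) =
        invDist e x y • fillVec e + (1 + invDist e x y) • fillVec (e.trans (swap x y)) := by
      rw [h0, semiOp, Finsupp.linearCombination_single, one_smul]
      have h2 : StdTableau.swapVec ⟨e, h⟩ x y = fillVec (e.trans (swap x y)) := rfl
      have h3 : ((StdTableau.axialDist ⟨e, h⟩ x y : ℤ) : ℂ)⁻¹ = invDist e x y :=
        (one_div _).symm
      rw [h2, one_div, h3]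
    rw [h1]
    by_cases h' : IsStd μ (e.trans (swap x y))
    · rw [offCoeff, if_pos ⟨h, h'⟩]
    · rw [fillVec, fillVec, dif_neg h', smul_zero, smul_zero]
  · simp [semiOp, fillVec, h, offCoeff]

theorem semiOp_fillVec' {e e' : μ.cells ≃ Fin n} {x y : Fin n} {A : ℂ}
    (he : e.trans (swap x y) = e') (hA : invDist e x y = A) :
    semiOp x y (fillVec e) = A • fillVec e + offCoeff e x y • fillVec e' := by
  rw [semiOp_fillVec, he, hA]

theorem isStd_of_between {e : μ.cells ≃ Fin n} (he : IsStd μ e) {ρ σ : Perm (Fin n)}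
    (hρ : IsStd μ (e.trans ρ)) (h : ∀ u v : Fin n, u < v → ρ u < ρ v → σ u < σ v) :
    IsStd μ (e.trans σ) :=
  ⟨fun p q h1 h2 => h _ _ (he.1 p q h1 h2) (hρ.1 p q h1 h2),
   fun p q h1 h2 => h _ _ (he.2 p q h1 h2) (hρ.2 p q h1 h2)⟩

theorem swap_order {x y u v : Fin n} (hxy : (x : ℕ) + 1 = y) (h : u < v)
    (h' : ¬ swap x y u < swap x y v) : u = x ∧ v = y := by
  simp only [swap_apply_def, Fin.ext_iff, Fin.lt_def] at *
  split_ifs at h' <;> omega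

theorem invDist_sq_of_not_isStd {e : μ.cells ≃ Fin n} (he : IsStd μ e) {x y : Fin n}
    (hxy : (x : ℕ) + 1 = y) (h : ¬ IsStd μ (e.trans (swap x y))) : invDist e x y ^ 2 = 1 := by
  rw [IsStd, not_and_or] at h
  rcases h with h | h
  · push Not at h
    obtain ⟨p, q, h1, h2, h3⟩ := h
    obtain ⟨rfl, rfl⟩ := swap_order hxy (he.1 p q h1 h2) (not_lt.2 h3)
    have hadj : p.1.2 + 1 = q.1.2 := by
      by_contra hne
      have hm : (p.1.1, p.1.2 + 1) ∈ μ.cells :=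
        μ.up_left_mem (h1.le) (by omega : p.1.2 + 1 ≤ q.1.2) (by simp)
      have a1 := he.1 p ⟨_, hm⟩ rfl (Nat.lt_succ_self _)
      have a2 := he.1 ⟨_, hm⟩ q h1 (by dsimp only; omega)
      rw [Fin.lt_def] at a1 a2
      omega
    have : content q.1 - content p.1 = 1 := by unfold content; omega
    simp [invDist, this]
  · push Not at h
    obtain ⟨p, q, h1, h2, h3⟩ := h
    obtain ⟨rfl, rfl⟩ := swap_order hxy (he.2 p q h1 h2) (not_lt.2 h3)
    have hadj : p.1.1 + 1 = q.1.1 := by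
      by_contra hne
      have hm : (p.1.1 + 1, p.1.2) ∈ μ.cells :=
        μ.up_left_mem (by omega : p.1.1 + 1 ≤ q.1.1) h1.le (by simp)
      have a1 := he.2 p ⟨_, hm⟩ rfl (Nat.lt_succ_self _)
      have a2 := he.2 ⟨_, hm⟩ q h1 (by dsimp only; omega)
      rw [Fin.lt_def] at a1 a2
      omega
    have : content q.1 - content p.1 = -1 := by unfold content; omega
    simp [invDist, this]

theorem trans_swap_swap (e : μ.cells ≃ Fin n) (x y : Fin n) :
    (e.trans (swap x y)).trans (swap x y) = e := by
  ext p; simp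

theorem invDist_trans_swap (e : μ.cells ≃ Fin n) (x y : Fin n) :
    invDist (e.trans (swap x y)) x y = -invDist e x y := by
  simp only [invDist, symm_trans_apply, symm_swap, swap_apply_left, swap_apply_right]
  rw [← neg_sub (content (e.symm y).1)]
  push_cast
  rw [div_neg]

theorem offCoeff_mul {e : μ.cells ≃ Fin n} (he : IsStd μ e) {x y : Fin n}
    (hxy : (x : ℕ) + 1 = y) :
    offCoeff e x y * offCoeff (e.trans (swap x y)) x y = 1 - invDist e x y ^ 2 := by
  by_cases h : IsStd μ (e.trans (swap x y))
  · simp only [offCoeff, trans_swap_swap, he, h, and_self, if_true, invDist_trans_swap]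
    ring
  · rw [invDist_sq_of_not_isStd he hxy h]
    simp [offCoeff, h, -coe_trans]

/-- Distinct boxes of a standard tableau on one diagonal have entries differing by at least `3`. -/
theorem content_ne {e : μ.cells ≃ Fin n} (he : IsStd μ e) {x y : Fin n} (hxy : x < y)
    (h3 : (y : ℕ) < x + 3) : content (e.symm y).1 ≠ content (e.symm x).1 := by
  intro hc
  obtain ⟨p, rfl⟩ := e.surjective x
  obtain ⟨q, rfl⟩ := e.surjective y
  simp only [symm_apply_apply] at hc
  have hpq : p ≠ q := by rintro rfl; exact lt_irrefl _ hxy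
  unfold content at hc
  rcases lt_trichotomy p.1.1 q.1.1 with h | h | h
  · have hm1 : (p.1.1, p.1.2 + 1) ∈ μ.cells :=
      μ.up_left_mem h.le (by omega : p.1.2 + 1 ≤ q.1.2) (by simp)
    have hm2 : (p.1.1 + 1, p.1.2) ∈ μ.cells :=
      μ.up_left_mem (by omega : p.1.1 + 1 ≤ q.1.1) (by omega : p.1.2 ≤ q.1.2) (by simp)
    have hm3 : (p.1.1 + 1, p.1.2 + 1) ∈ μ.cells :=
      μ.up_left_mem (by omega : p.1.1 + 1 ≤ q.1.1) (by omega : p.1.2 + 1 ≤ q.1.2)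
        (by simp)
    have a1 := he.1 p ⟨_, hm1⟩ rfl (Nat.lt_succ_self _)
    have a2 := he.2 p ⟨_, hm2⟩ rfl (Nat.lt_succ_self _)
    have a3 := he.2 ⟨_, hm1⟩ ⟨_, hm3⟩ rfl (Nat.lt_succ_self _)
    have a4 := he.1 ⟨_, hm2⟩ ⟨_, hm3⟩ rfl (Nat.lt_succ_self _)
    have a5 : e ⟨_, hm3⟩ ≤ e q := by
      rcases Nat.lt_or_ge (p.1.1 + 1) q.1.1 with h5 | h5
      · have hm4 : (q.1.1, p.1.2 + 1) ∈ μ.cells :=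
          μ.up_left_mem le_rfl (by omega : p.1.2 + 1 ≤ q.1.2) (by simp)
        have b1 := he.2 ⟨_, hm3⟩ ⟨_, hm4⟩ rfl h5
        have b2 := he.1 ⟨_, hm4⟩ q rfl (by dsimp only; omega)
        exact (b1.trans b2).le
      · apply le_of_eq
        congr 1
        ext1
        exact Prod.ext (by dsimp only; omega) (by dsimp only; omega)
    have a6 : e ⟨_, hm1⟩ ≠ e ⟨_, hm2⟩ := by
      intro h6
      have := congrArg (fun c => c.1.1) (e.injective h6)
      dsimp only at this
      omega
    rw [ne_eq, Fin.ext_iff] at a6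
    simp only [Fin.lt_def, Fin.le_def] at *
    omega
  · apply hpq
    ext1
    exact Prod.ext h (by omega)
  · have hm1 : (q.1.1, p.1.2) ∈ μ.cells :=
      μ.up_left_mem h.le le_rfl (by simp)
    have b1 := he.1 q ⟨_, hm1⟩ rfl (by dsimp only; omega)
    have b2 := he.2 ⟨_, hm1⟩ p rfl h
    exact lt_asymm hxy (b1.trans b2)

theorem semi_ext {f g : Module.End ℂ (StdTableau μ (Fin n) →₀ ℂ)}
    (h : ∀ e : μ.cells ≃ Fin n, IsStd μ e → f (fillVec e) = g (fillVec e)) : f = g := by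
  refine Finsupp.lhom_ext' fun T => LinearMap.ext_ring ?_
  have := h T.entry T.std
  simpa [fillVec, T.std] using this

theorem semiOp_sq {x y : Fin n} (hxy : (x : ℕ) + 1 = y) :
    semiOp x y * semiOp x y = (1 : Module.End ℂ (StdTableau μ (Fin n) →₀ ℂ)) := by
  refine semi_ext fun e he => ?_
  have h1 := semiOp_fillVec e x y
  have h2 := semiOp_fillVec' (trans_swap_swap e x y) (invDist_trans_swap e x y)
  have h3 := offCoeff_mul he hxy
  rw [Module.End.mul_apply, h1]
  simp only [map_add, map_smul, h1, h2, Module.End.one_apply]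
  linear_combination (norm := module) h3 • fillVec e

theorem semiOp_comm {x y x' y' : Fin n} (h1 : (x : ℕ) + 1 = y) (h2 : (x' : ℕ) + 1 = y')
    (h : y < x') :
    semiOp x y * semiOp x' y' =
      (semiOp x' y' * semiOp x y : Module.End ℂ (StdTableau μ (Fin n) →₀ ℂ)) := by
  refine semi_ext fun e he => ?_
  simp only [Module.End.mul_apply]
  rw [Fin.lt_def] at h
  have n1 : x ≠ x' := by rintro rfl; omega
  have n2 : x ≠ y' := by rintro rfl; omega
  have n3 : y ≠ x' := by rintro rfl; omega
  have n4 : y ≠ y' := by rintro rfl; omega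
  have hsw : swap x' y' * swap x y = swap x y * swap x' y' := by
    ext z
    simp only [Perm.mul_apply, swap_apply_def, Fin.ext_iff] at *
    split_ifs <;> omega
  have e1 : (e.trans (swap x y)).trans (swap x' y') = e.trans (swap x' y' * swap x y) := rfl
  have e2 : (e.trans (swap x' y')).trans (swap x y) = e.trans (swap x' y' * swap x y) := by
    rw [hsw]; rfl
  have d1 : invDist (e.trans (swap x y)) x' y' = invDist e x' y' := by
    simp [invDist, swap_apply_of_ne_of_ne, n1.symm, n2.symm, n3.symm, n4.symm]
  have d2 : invDist (e.trans (swap x' y')) x y = invDist e x y := by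
    simp [invDist, swap_apply_of_ne_of_ne, n1, n2, n3, n4]
  refine comm_aux _ _ (semiOp_fillVec e x y) (semiOp_fillVec e x' y') (semiOp_fillVec' e1 d1)
    (semiOp_fillVec' e2 d2) ?_
  by_cases hs : IsStd μ (e.trans (swap x' y' * swap x y))
  · have s1 : IsStd μ (e.trans (swap x y)) := by
      refine isStd_of_between he hs fun u v huv hρ => ?_
      by_contra hc
      obtain ⟨rfl, rfl⟩ := swap_order h1 huv hc
      simp only [Perm.mul_apply, swap_apply_left, swap_apply_right,
        swap_apply_of_ne_of_ne n1 n2, swap_apply_of_ne_of_ne n3 n4] at hρ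
      exact lt_asymm huv hρ
    have s2 : IsStd μ (e.trans (swap x' y')) := by
      refine isStd_of_between he hs fun u v huv hρ => ?_
      by_contra hc
      obtain ⟨rfl, rfl⟩ := swap_order h2 huv hc
      simp only [Perm.mul_apply, swap_apply_left, swap_apply_right,
        swap_apply_of_ne_of_ne n1.symm n3.symm, swap_apply_of_ne_of_ne n2.symm n4.symm] at hρ
      exact lt_asymm huv hρ
    congr 1
    simp only [offCoeff, he, s1, s2, e1, e2, hs, d1, d2, and_self, if_true]
    ring
  · simp [fillVec, hs, -coe_trans]

theorem semiOp_braid {x y z : Fin n} (hxy : (x : ℕ) + 1 = y) (hyz : (y : ℕ) + 1 = z) :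
    semiOp x y * semiOp y z * semiOp x y =
      (semiOp y z * semiOp x y * semiOp y z : Module.End ℂ (StdTableau μ (Fin n) →₀ ℂ)) := by
  refine semi_ext fun e he => ?_
  simp only [Module.End.mul_apply]
  have n1 : x ≠ y := by rintro rfl; omega
  have n2 : x ≠ z := by rintro rfl; omega
  have n3 : y ≠ z := by rintro rfl; omega
  have hxy' : x < y := Fin.lt_def.2 (by omega)
  have hyz' : y < z := Fin.lt_def.2 (by omega)
  have ry : swap x z y = y := swap_apply_of_ne_of_ne n1.symm n3
  have k1 : ¬ swap x z x < swap x z y := by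
    rw [swap_apply_left, ry]; exact hyz'.not_gt
  have k2 : ¬ swap x z y < swap x z z := by
    rw [swap_apply_right, ry]; exact hxy'.not_gt
  have k3 : ¬ swap x z x < swap x z z := by
    rw [swap_apply_left, swap_apply_right]; exact (hxy'.trans hyz').not_gt
  have e1 : ((e.trans (swap x y)).trans (swap y z)).trans (swap x y) = e.trans (swap x z) := by
    ext p : 1
    simp only [trans_apply, swap_apply_def, Fin.ext_iff] at *
    split_ifs <;> omega
  have e2 : ((e.trans (swap y z)).trans (swap x y)).trans (swap y z) = e.trans (swap x z) := by
    ext p : 1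
    simp only [trans_apply, swap_apply_def, Fin.ext_iff] at *
    split_ifs <;> omega
  have d1 : invDist (e.trans (swap x y)) y z = invDist e x z := by
    simp [invDist, swap_apply_of_ne_of_ne, n2.symm, n3.symm]
  have d2 : invDist (e.trans (swap y z)) x y = invDist e x z := by
    simp [invDist, swap_apply_of_ne_of_ne, n1, n2]
  have d3 : invDist ((e.trans (swap x y)).trans (swap y z)) x y = invDist e y z := by
    simp [invDist, swap_apply_of_ne_of_ne, n1, n2, n2.symm, n3.symm]
  have d4 : invDist ((e.trans (swap y z)).trans (swap x y)) y z = invDist e x y := by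
    simp [invDist, swap_apply_of_ne_of_ne, n1, n2, n2.symm, n3.symm]
  refine braid_aux _ _ (semiOp_fillVec e x y) (semiOp_fillVec e y z)
    (semiOp_fillVec' (trans_swap_swap e x y) (invDist_trans_swap e x y))
    (semiOp_fillVec' (trans_swap_swap e y z) (invDist_trans_swap e y z))
    (semiOp_fillVec' rfl d1) (semiOp_fillVec' rfl d2) (semiOp_fillVec' e1 d3)
    (semiOp_fillVec' e2 d4) (offCoeff_mul he hxy) (offCoeff_mul he hyz) ?_ ?_
  · have c1 := content_ne he (x := x) (y := y) (Fin.lt_def.2 (by omega)) (by omega)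
    have c2 := content_ne he (x := y) (y := z) (Fin.lt_def.2 (by omega)) (by omega)
    have c3 := content_ne he (x := x) (y := z) (Fin.lt_def.2 (by omega)) (by omega)
    unfold invDist
    generalize content (e.symm x).1 = a at *
    generalize content (e.symm y).1 = b at *
    generalize content (e.symm z).1 = c at *
    have l1 : (b : ℂ) - a ≠ 0 := sub_ne_zero.2 (by exact_mod_cast c1)
    have l2 : (c : ℂ) - b ≠ 0 := sub_ne_zero.2 (by exact_mod_cast c2)
    have l3 : (c : ℂ) - a ≠ 0 := sub_ne_zero.2 (by exact_mod_cast c3)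
    push_cast
    field_simp
    ring
  · by_cases hs : IsStd μ (e.trans (swap x z))
    · have s1 : IsStd μ (e.trans (swap x y)) := by
        refine isStd_of_between he hs fun u v huv hρ => ?_
        by_contra hc
        obtain ⟨rfl, rfl⟩ := swap_order hxy huv hc
        exact k1 hρ
      have s2 : IsStd μ (e.trans (swap y z)) := by
        refine isStd_of_between he hs fun u v huv hρ => ?_
        by_contra hc
        obtain ⟨rfl, rfl⟩ := swap_order hyz huv hc
        exact k2 hρ
      have s3 : IsStd μ ((e.trans (swap x y)).trans (swap y z)) := by
        refine isStd_of_between (σ := swap y z * swap x y) he hs fun u v huv hρ => ?_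
        by_contra hc
        by_cases hlt : swap x y u < swap x y v
        · obtain ⟨ha, hb⟩ := swap_order hyz hlt hc
          rw [swap_apply_eq_iff, swap_apply_right] at ha
          rw [swap_apply_eq_iff, swap_apply_of_ne_of_ne n2.symm n3.symm] at hb
          subst ha hb
          exact k3 hρ
        · obtain ⟨rfl, rfl⟩ := swap_order hxy huv hlt
          exact k1 hρ
      have s4 : IsStd μ ((e.trans (swap y z)).trans (swap x y)) := by
        refine isStd_of_between (σ := swap x y * swap y z) he hs fun u v huv hρ => ?_
        by_contra hc
        by_cases hlt : swap y z u < swap y z v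
        · obtain ⟨ha, hb⟩ := swap_order hxy hlt hc
          rw [swap_apply_eq_iff, swap_apply_of_ne_of_ne n1 n2] at ha
          rw [swap_apply_eq_iff, swap_apply_left] at hb
          subst ha hb
          exact k3 hρ
        · obtain ⟨rfl, rfl⟩ := swap_order hyz huv hlt
          exact k2 hρ
      congr 1
      simp only [offCoeff, he, s1, s2, s3, s4, e1, e2, hs, d1, d2, d3, d4, and_self, if_true]
      ring
    · simp [fillVec, hs, -coe_trans]

end Seminormal

/-- Young's seminormal formula does define a representation of the symmetric group. -/
theorem exists_isSeminormal (μ : YoungDiagram) : ∃ ψ, IsSeminormal μ ψ := by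
  let A : ℕ → Module.End ℂ (StdTableau μ (Fin μ.card) →₀ ℂ) := fun i =>
    if h : i + 1 < μ.card then semiOp ⟨i, by omega⟩ ⟨i + 1, h⟩ else 1
  have hA : CoxRel A μ.card := by
    constructor
    · intro i h
      simp only [A, h, dif_pos]
      exact semiOp_sq rfl
    · intro i j hij h
      simp only [A, h, (by omega : i + 1 < μ.card), dif_pos]
      exact semiOp_comm rfl rfl (Fin.lt_def.2 hij)
    · intro i h
      simp only [A, (by omega : i + 1 < μ.card), (by omega : i + 1 + 1 < μ.card), dif_pos]
      exact semiOp_braid rfl rfl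
  obtain ⟨φ, hφ⟩ := hA.exists_hom
  refine ⟨φ, fun T x y hxy => ?_⟩
  have hx : (x : ℕ) + 1 < μ.card := by omega
  have e1 : (⟨(x : ℕ), by omega⟩ : Fin μ.card) = x := rfl
  have e2 : (⟨(x : ℕ) + 1, hx⟩ : Fin μ.card) = y := Fin.ext hxy
  rw [hφ x y hxy]
  simp only [A, hx, dif_pos, e2, Fin.eta]
  simp [semiOp]

/-- The irreducible representation of the symmetric group on `|μ|` letters labelled by the
partition `μ` (the complex Specht module), in Young's seminormal form: the basis `v_T`, for
`T ∈ ST(μ)`, is `Finsupp.single T 1`, and the action is the one given by the seminormal formula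
(see `youngRep_isSeminormal`). -/
noncomputable def youngRep (μ : YoungDiagram) :
    Representation ℂ (Perm (Fin μ.card)) (StdTableau μ (Fin μ.card) →₀ ℂ) :=
  (exists_isSeminormal μ).choose

theorem youngRep_isSeminormal (μ : YoungDiagram) : IsSeminormal μ (youngRep μ) :=
  (exists_isSeminormal μ).choose_spec

end GdOneR

/-! ### Multitableaux and the two models -/

namespace GdOneR

open Equiv Finset
open scoped TensorProduct

/-- The group `G(d,1,r)`: pairs `(z; σ)` with `z` a tuple of `d`th roots of unity and `σ` a
permutation, where `σ z σ⁻¹ = z ∘ σ⁻¹`. -/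
abbrev Grp (d r : ℕ) : Type :=
  (Fin r → rootsOfUnity d ℂ) ⋊[mulAutArrow] Perm (Fin r)

/-- The generator `t = (ζ, 1, …, 1)`. -/
def tGen {d r : ℕ} (hr : 0 < r) (ζ : rootsOfUnity d ℂ) : Grp d r :=
  SemidirectProduct.inl (Pi.mulSingle ⟨0, hr⟩ ζ)

/-- `d`-multipartitions of `r`. -/
structure Multipartition (d r : ℕ) where
  /-- the partitions `λ⁽⁰⁾, …, λ⁽ᵈ⁻¹⁾`, as Young diagrams -/
  shape : Fin d → YoungDiagram
  sum_card : ∑ i, (shape i).card = r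

variable {d r : ℕ}

/-- Standard multitableaux: each of the `r` integers (counted from `0`) appears exactly once in
one of the tableaux, and each tableau is increasing along rows and columns. -/
@[ext] structure StdMultitableau (Λ : Multipartition d r) where
  /-- the entry in each box -/
  entry : (Σ i, (Λ.shape i).cells) ≃ Fin r
  std : ∀ i, IsStd (Λ.shape i) fun p => entry ⟨i, p⟩

namespace StdMultitableau

variable {Λ : Multipartition d r} (T : StdMultitableau Λ)

/-- `T(x)`: the index of the tableau containing `x`. -/
def index (x : Fin r) : Fin d := (T.entry.symm x).1

/-- The axial distance between two entries (used when they are in the same tableau). -/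
def axialDist (x y : Fin r) : ℤ :=
  content (T.entry.symm y).2.1 - content (T.entry.symm x).2.1

open Classical in
/-- The basis vector of the multitableau obtained from `T` by exchanging `x` and `y`, read as `0`
when the resulting filling is not standard (for consecutive `x`, `y` this happens only when they
are in adjacent boxes of one and the same tableau). -/
noncomputable def swapVec (x y : Fin r) : StdMultitableau Λ →₀ ℂ :=
  if h : ∀ i, IsStd (Λ.shape i) fun p => (T.entry.trans (swap x y)) ⟨i, p⟩ then
    Finsupp.single ⟨T.entry.trans (swap x y), h⟩ 1
  else 0

/-- The set `E(Tᵢ)` of integers occurring in the `i`th tableau. -/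
def entrySet (i : Fin d) : Finset (Fin r) :=
  univ.image fun p : (Λ.shape i).cells => T.entry ⟨i, p⟩

/-- The `i`th tableau `Tᵢ`, a standard tableau with respect to `E(Tᵢ)`. -/
noncomputable def component (i : Fin d) : StdTableau (Λ.shape i) (T.entrySet i) where
  entry := Equiv.ofBijective
    (fun p => ⟨T.entry ⟨i, p⟩, mem_image_of_mem _ (mem_univ p)⟩)
    ⟨fun p q h => by
      simpa using T.entry.injective (congrArg Subtype.val h), fun ⟨x, hx⟩ => by
      obtain ⟨p, -, hp⟩ := mem_image.1 hx
      exact ⟨p, Subtype.ext hp⟩⟩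
  std := ⟨fun p q h1 h2 => (T.std i).1 p q h1 h2, fun p q h1 h2 => (T.std i).2 p q h1 h2⟩

end StdMultitableau

/-- The map `θ`: if `t₁ < ⋯ < tₖ` are the entries of `T`, replace the entry `tⱼ` by `j`. -/
noncomputable def StdTableau.theta {μ : YoungDiagram} {α : Type*} [LinearOrder α] [Fintype α]
    (T : StdTableau μ α) : StdTableau μ (Fin μ.card) :=
  let ι : Fin μ.card ≃o α := Fintype.orderIsoFinOfCardEq α
    ((Fintype.card_congr T.entry).symm.trans (Fintype.card_coe _))
  { entry := T.entry.trans ι.symm.toEquiv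
    std := ⟨fun p q h1 h2 => ι.symm.strictMono (T.std.1 p q h1 h2),
      fun p q h1 h2 => ι.symm.strictMono (T.std.2 p q h1 h2)⟩ }

/-- The formulas for the action of the generators `t, s₁, …, s_{r-1}` on the standard
multitableaux which describe the Marin–Michel representation. -/
structure IsMarinMichel (hr : 0 < r) (ζ : rootsOfUnity d ℂ) (Λ : Multipartition d r)
    (ρ' : Representation ℂ (Grp d r) (StdMultitableau Λ →₀ ℂ)) : Prop where
  apply_t : ∀ T : StdMultitableau Λ, ρ' (tGen hr ζ) (Finsupp.single T 1) =
    (((ζ : ℂˣ) : ℂ) ^ (T.index ⟨0, hr⟩ : ℕ)) • Finsupp.single T 1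
  apply_s_of_ne : ∀ (T : StdMultitableau Λ) (x y : Fin r), (x : ℕ) + 1 = y →
    T.index x ≠ T.index y →
    ρ' (SemidirectProduct.inr (swap x y)) (Finsupp.single T 1) = T.swapVec x y
  apply_s_of_eq : ∀ (T : StdMultitableau Λ) (x y : Fin r), (x : ℕ) + 1 = y →
    T.index x = T.index y →
    ρ' (SemidirectProduct.inr (swap x y)) (Finsupp.single T 1) =
      (1 / (T.axialDist x y : ℂ)) • Finsupp.single T 1 +
        (1 + 1 / (T.axialDist x y : ℂ)) • T.swapVec x y

namespace Multipartition

variable (Λ : Multipartition d r)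

/-- The composition `c = (|λ⁽⁰⁾|, …, |λ⁽ᵈ⁻¹⁾|)` of `r`. -/
abbrev comp (i : Fin d) : ℕ := (Λ.shape i).card

/-- The bijection `(i, j) ↦ Cᵢ + j`, where `Cᵢ = c₀ + ⋯ + c_{i-1}`. The block `Eᵢ` is the set of
the images of the pairs `(i, j)`. -/
def blockEquiv : (Σ i, Fin (Λ.comp i)) ≃ Fin r :=
  finSigmaFinEquiv.trans (finCongr Λ.sum_card)

/-- The index `i` of the block `Eᵢ` containing `x`. -/
def block (x : Fin r) : Fin d := (Λ.blockEquiv.symm x).1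

/-- The Young subgroup: the permutations preserving every block `Eᵢ`. -/
def youngSubgroup : Subgroup (Perm (Fin r)) where
  carrier := {σ | ∀ x, Λ.block (σ x) = Λ.block x}
  mul_mem' {σ τ} hσ hτ x := (hσ (τ x)).trans (hτ x)
  one_mem' _ := rfl
  inv_mem' {σ} hσ x := by
    have := hσ (σ⁻¹ x)
    rw [← Perm.mul_apply, mul_inv_cancel, Perm.one_apply] at this
    exact this.symm

theorem blockEquiv_snd {σ : Perm (Fin r)} (hσ : σ ∈ Λ.youngSubgroup) (i : Fin d)
    (j : Fin (Λ.comp i)) :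
    (Λ.blockEquiv.symm (σ (Λ.blockEquiv ⟨i, j⟩))).1 = i := by
  have := hσ (Λ.blockEquiv ⟨i, j⟩)
  simpa [block] using this

/-- The position, within the block `Eᵢ`, of the image of `Cᵢ + j` under `σ`. -/
def localFun (σ : Λ.youngSubgroup) (i : Fin d) (j : Fin (Λ.comp i)) : Fin (Λ.comp i) :=
  Fin.cast (congrArg Λ.comp (Λ.blockEquiv_snd σ.2 i j))
    (Λ.blockEquiv.symm (σ.1 (Λ.blockEquiv ⟨i, j⟩))).2

theorem blockEquiv_localFun (σ : Λ.youngSubgroup) (i : Fin d) (j : Fin (Λ.comp i)) :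
    Λ.blockEquiv ⟨i, Λ.localFun σ i j⟩ = σ.1 (Λ.blockEquiv ⟨i, j⟩) := by
  rw [← Equiv.eq_symm_apply]
  have key : ∀ (p : Σ i, Fin (Λ.comp i)) (h : p.1 = i),
      (⟨i, Fin.cast (congrArg Λ.comp h) p.2⟩ : Σ i, Fin (Λ.comp i)) = p := by
    rintro ⟨a, b⟩ rfl
    rfl
  exact key _ (Λ.blockEquiv_snd σ.2 i j)

theorem localFun_eq_iff (σ : Λ.youngSubgroup) (i : Fin d) (j k : Fin (Λ.comp i)) :
    Λ.localFun σ i j = k ↔ σ.1 (Λ.blockEquiv ⟨i, j⟩) = Λ.blockEquiv ⟨i, k⟩ := by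
  rw [← blockEquiv_localFun]
  simp

theorem localFun_mul (σ τ : Λ.youngSubgroup) (i : Fin d) (j : Fin (Λ.comp i)) :
    Λ.localFun (σ * τ) i j = Λ.localFun σ i (Λ.localFun τ i j) := by
  rw [localFun_eq_iff, blockEquiv_localFun, blockEquiv_localFun]
  rfl

theorem localFun_one (i : Fin d) (j : Fin (Λ.comp i)) : Λ.localFun 1 i j = j := by
  rw [localFun_eq_iff]
  rfl

/-- The homomorphism from the Young subgroup to the symmetric group on `cᵢ` letters: restrict to
the block `Eᵢ` and identify `Eᵢ` with `cᵢ` letters through `Cᵢ + j ↦ j`. -/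
def localPerm (i : Fin d) : Λ.youngSubgroup →* Perm (Fin (Λ.comp i)) where
  toFun σ :=
    { toFun := Λ.localFun σ i
      invFun := Λ.localFun σ⁻¹ i
      left_inv := fun j => by rw [← localFun_mul, inv_mul_cancel, localFun_one]
      right_inv := fun j => by rw [← localFun_mul, mul_inv_cancel, localFun_one] }
  map_one' := by ext1 j; exact Λ.localFun_one i j
  map_mul' σ τ := by ext1 j; exact Λ.localFun_mul σ τ i j

/-- The subgroup `G_c`: the elements `(z; σ)` with `σ` in the Young subgroup. -/
def inertia : Subgroup (Grp d r) := Λ.youngSubgroup.comap SemidirectProduct.rightHom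

/-- The projection from `G_c` to the Young subgroup. -/
def inertiaProj : Λ.inertia →* Λ.youngSubgroup where
  toFun g := ⟨g.1.right, g.2⟩
  map_one' := rfl
  map_mul' _ _ := rfl

/-- The linear character `α_c` of `G_c`: a coordinate in the block `Eᵢ` contributes its `i`th
power, and the Young subgroup acts trivially. -/
def inertiaChar : Λ.inertia →* ℂ where
  toFun g := ∏ x, ((g.1.left x : ℂˣ) : ℂ) ^ (Λ.block x : ℕ)
  map_one' := by simp
  map_mul' g h := by
    have hb : ∀ x, Λ.block (g.1.right⁻¹ x) = Λ.block x := Λ.youngSubgroup.inv_mem g.2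
    have h1 : ∏ x, ((h.1.left (g.1.right⁻¹ x) : ℂˣ) : ℂ) ^ (Λ.block x : ℕ) =
        ∏ x, ((h.1.left x : ℂˣ) : ℂ) ^ (Λ.block x : ℕ) := by
      rw [← Equiv.prod_comp (g.1.right⁻¹) fun x => ((h.1.left x : ℂˣ) : ℂ) ^ (Λ.block x : ℕ)]
      exact prod_congr rfl fun x _ => by rw [hb]
    rw [← h1, ← prod_mul_distrib]
    refine prod_congr rfl fun x _ => ?_
    rw [← mul_pow]
    rfl

/-- The representation of `G_c` on `V_{λ⁽⁰⁾} ⊗ ⋯ ⊗ V_{λ⁽ᵈ⁻¹⁾}`: the Young subgroup acts through its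
factors on the tensor factors, and this action is twisted by the character `α_c`. -/
noncomputable def tensorHom : Λ.inertia →*
    Module.End ℂ (⨂[ℂ] i, (StdTableau (Λ.shape i) (Fin (Λ.shape i).card) →₀ ℂ)) where
  toFun g := Λ.inertiaChar g •
    PiTensorProduct.map fun i => youngRep (Λ.shape i) (Λ.localPerm i (Λ.inertiaProj g))
  map_one' := by
    simp only [map_one, one_smul]
    exact PiTensorProduct.map_one (R := ℂ)
  map_mul' g h := by
    simp only [map_mul]
    rw [PiTensorProduct.map_mul, smul_mul_smul_comm]

/-- The space `V_λ = V_{λ⁽⁰⁾} ⊗ ⋯ ⊗ V_{λ⁽ᵈ⁻¹⁾}`. -/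
def TensorSpace : Type :=
  ⨂[ℂ] i, (StdTableau (Λ.shape i) (Fin (Λ.shape i).card) →₀ ℂ)

noncomputable instance : AddCommGroup Λ.TensorSpace :=
  inferInstanceAs (AddCommGroup (⨂[ℂ] i, (StdTableau (Λ.shape i) (Fin (Λ.shape i).card) →₀ ℂ)))

noncomputable instance : Module ℂ Λ.TensorSpace :=
  inferInstanceAs (Module ℂ (⨂[ℂ] i, (StdTableau (Λ.shape i) (Fin (Λ.shape i).card) →₀ ℂ)))

/-- The representation `V_λ` of `G_c`. -/
noncomputable def tensorRep : Representation ℂ Λ.inertia Λ.TensorSpace := Λ.tensorHom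

/-- The vector `v_{λ⁽⁰⁾,S₀} ⊗ ⋯ ⊗ v_{λ⁽ᵈ⁻¹⁾,S_{d-1}}` of `V_λ`. -/
noncomputable def tensorVec (S : ∀ i, StdTableau (Λ.shape i) (Fin (Λ.shape i).card)) :
    Λ.TensorSpace :=
  PiTensorProduct.tprod ℂ fun i => Finsupp.single (S i) 1

/-- The space of the representation of `G(d,1,r)` induced from `G_c`. -/
abbrev IndSpace : Type := Representation.IndV Λ.inertia.subtype Λ.tensorRep

/-- The James–Kerber representation `Ind_{G_c}^G V_λ`. -/
noncomputable def jamesKerberRep : Representation ℂ (Grp d r) Λ.IndSpace :=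
  Representation.ind Λ.inertia.subtype Λ.tensorRep

/-- The vector `g ⊗ v` of the induced representation `ℂ[G] ⊗_{ℂ[G_c]} V_λ`. Mathlib's model of the
induced representation is the space of coinvariants of `ℂ[G] ⊗ V_λ` for
`h • (x ⊗ v) = h x ⊗ h v`, on which `g` acts by `x ⊗ v ↦ x g⁻¹ ⊗ v`; it is identified with
`ℂ[G] ⊗_{ℂ[G_c]} V_λ` by `x ⊗ v ↦ x⁻¹ ⊗ v`. -/
noncomputable def indVec (g : Grp d r) (v : Λ.TensorSpace) : Λ.IndSpace :=
  Representation.IndV.mk Λ.inertia.subtype Λ.tensorRep g⁻¹ v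

/-- The set `𝒳_c` of tuples of disjoint subsets `Xᵢ` with union the set of all `r` letters and
`|Xᵢ| = cᵢ`. -/
structure SetComposition where
  /-- the subsets `X₀, …, X_{d-1}` -/
  part : Fin d → Finset (Fin r)
  disjoint : ∀ i j, i ≠ j → Disjoint (part i) (part j)
  union : univ.biUnion part = univ
  card_part : ∀ i, (part i).card = Λ.comp i

/-- The permutation `t_X`, sending `Cᵢ + j` to the `j`th element of `Xᵢ`. -/
noncomputable def SetComposition.perm {Λ : Multipartition d r} (X : Λ.SetComposition) :
    Perm (Fin r) :=
  Equiv.ofBijective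
    (fun x => (X.part (Λ.blockEquiv.symm x).1).orderEmbOfFin (X.card_part _)
      (Λ.blockEquiv.symm x).2)
    (Finite.injective_iff_bijective.1 fun x y h => by
      apply Λ.blockEquiv.symm.injective
      generalize Λ.blockEquiv.symm x = p at *
      generalize Λ.blockEquiv.symm y = q at *
      obtain ⟨i, a⟩ := p
      obtain ⟨j, b⟩ := q
      by_cases hij : i = j
      · subst hij
        simpa using h
      · have h1 := (X.part i).orderEmbOfFin_mem (X.card_part i) a
        have h2 := (X.part j).orderEmbOfFin_mem (X.card_part j) b
        dsimp only at h
        rw [h] at h1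
        exact absurd h2 (disjoint_left.1 (X.disjoint i j hij) h1))

end Multipartition

/-- The tuple `(E(T₀), …, E(T_{d-1}))` of the entry sets of a standard multitableau. -/
def StdMultitableau.entrySets {Λ : Multipartition d r} (T : StdMultitableau Λ) :
    Λ.SetComposition where
  part := T.entrySet
  disjoint i j hij := by
    rw [disjoint_left]
    intro x hx hy
    obtain ⟨p, -, rfl⟩ := mem_image.1 hx
    obtain ⟨q, -, hq⟩ := mem_image.1 hy
    exact hij (congrArg Sigma.fst (T.entry.injective hq)).symm
  union := by
    refine eq_univ_of_forall fun x => mem_biUnion.2 ⟨(T.entry.symm x).1, mem_univ _, ?_⟩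
    exact mem_image.2 ⟨(T.entry.symm x).2, mem_univ _, T.entry.apply_symm_apply x⟩
  card_part i := by
    rw [StdMultitableau.entrySet, card_image_of_injective _ fun p q h => by simpa using h]
    simp [Multipartition.comp]

/-- The vector `t_X ⊗ v_{λ⁽⁰⁾,S₀} ⊗ ⋯ ⊗ v_{λ⁽ᵈ⁻¹⁾,S_{d-1}}` of the James–Kerber model. -/
noncomputable def Multipartition.jkVec (Λ : Multipartition d r) (X : Λ.SetComposition)
    (S : ∀ i, StdTableau (Λ.shape i) (Fin (Λ.shape i).card)) : Λ.IndSpace :=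
  Λ.indVec (SemidirectProduct.inr X.perm) (Λ.tensorVec S)

end GdOneR

open GdOneR

/-! ### Coset representatives of the Young subgroup -/

namespace GdOneR

open Equiv Finset

variable {d r : ℕ}

namespace Multipartition

variable {Λ : Multipartition d r}

/-! The Marin–Michel action is obtained by transport of structure, so the defining relations of $G$
are never checked on its formulas.

The $t_X$ represent the cosets of $\mathfrak S_c$ in $\mathfrak S_r$, hence those of $G_c$ in $G$.
The vectors $t_X\otimes v_{S_0}\otimes\dots\otimes v_{S_{d-1}}$ therefore form a basis of the
induced module: `jkCoord_jkVec` gives a dual family and `eq_top_of_jkVec_mem` the spanning. A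
multitableau amounts to a pair $(X,S)$, with entry $t_X(C_i+S_i(p))$ in the box $p$ of the $i$th
diagram (`entry_eq`, `exists_entrySets_eq`). So $f$ matches two bases and is a linear isomorphism.

The James–Kerber action, pulled back along $f$, obeys the required formulas. Moving $t$ past $t_X$
puts $\zeta$ in the coordinate $t_X^{-1}(1)$, where the character of $G_c$ evaluates it. If $i,i+1$
lie in different parts of $X$, then $s_it_X=t_{X'}$, with $X'$ obtained by exchanging them. If they
lie in the same part, they are neighbours in its enumeration, so $s_it_X=t_Xs$ for a simple
transposition $s$ of one block, and Young's formula applies in one tensor factor. Since $t$ and the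
$s_i$ generate $G$, the structure is unique, and $f$ intertwines it by construction. -/

theorem block_blockEquiv (i : Fin d) (j : Fin (Λ.comp i)) : Λ.block (Λ.blockEquiv ⟨i, j⟩) = i := by
  simp [block]

namespace SetComposition

theorem perm_blockEquiv (X : Λ.SetComposition) (i : Fin d) (j : Fin (Λ.comp i)) :
    X.perm (Λ.blockEquiv ⟨i, j⟩) = (X.part i).orderEmbOfFin (X.card_part i) j := by
  have key : ∀ p : Σ i, Fin (Λ.comp i), p = ⟨i, j⟩ →
      (X.part p.1).orderEmbOfFin (X.card_part p.1) p.2 =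
        (X.part i).orderEmbOfFin (X.card_part i) j := by
    rintro _ rfl
    rfl
  rw [perm, ofBijective_apply]
  exact key _ (Λ.blockEquiv.symm_apply_apply _)

theorem strictMono_perm (X : Λ.SetComposition) (i : Fin d) :
    StrictMono fun j : Fin (Λ.comp i) => X.perm (Λ.blockEquiv ⟨i, j⟩) := by
  simp only [perm_blockEquiv]
  exact ((X.part i).orderEmbOfFin (X.card_part i)).strictMono

/-- By construction $t_X$ sends $E_i$ into $X_i$; disjointness of the parts gives the converse. Thus
$X_i=t_X(E_i)$, and $X$ can be read off from the coset of $t_X$. -/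
theorem mem_part_iff (X : Λ.SetComposition) (i : Fin d) (x : Fin r) :
    x ∈ X.part i ↔ Λ.block (X.perm⁻¹ x) = i := by
  have key : ∀ y, X.perm y ∈ X.part (Λ.block y) := by
    intro y
    obtain ⟨⟨i, j⟩, rfl⟩ := Λ.blockEquiv.surjective y
    rw [block_blockEquiv, perm_blockEquiv]
    exact orderEmbOfFin_mem _ _ _
  have hx := key (X.perm⁻¹ x)
  rw [← Perm.mul_apply, mul_inv_cancel, Perm.one_apply] at hx
  constructor
  · intro h
    by_contra hne
    exact disjoint_left.1 (X.disjoint _ _ hne) hx h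
  · rintro rfl
    exact hx

theorem eq_of_part {X Y : Λ.SetComposition} (h : X.part = Y.part) : X = Y := by
  cases X
  cases Y
  simpa using h

/-- The permutations `t_X` lie in distinct cosets of the Young subgroup. -/
theorem eq_of_perm_inv_mul_mem {X Y : Λ.SetComposition} (h : X.perm⁻¹ * Y.perm ∈ Λ.youngSubgroup) :
    X = Y := by
  refine eq_of_part (funext fun i => Finset.ext fun x => ?_)
  have := h (Y.perm⁻¹ x)
  rw [Perm.mul_apply, ← Perm.mul_apply Y.perm, mul_inv_cancel, Perm.one_apply] at this
  rw [mem_part_iff, mem_part_iff, this]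

/-- The permutations `t_X` represent all cosets of the Young subgroup. -/
theorem exists_perm_inv_mul_mem (Λ : Multipartition d r) (σ : Perm (Fin r)) :
    ∃ X : Λ.SetComposition, X.perm⁻¹ * σ ∈ Λ.youngSubgroup := by
  classical
  -- Take $X_i=\sigma(E_i)$: then $t_X$ and $\sigma$ both carry $E_i$ onto $X_i$, so they differ by
  -- a permutation preserving the blocks.
  let X : Λ.SetComposition :=
    { part := fun i => univ.filter fun x => Λ.block (σ⁻¹ x) = i
      disjoint := fun i j hij => by
        rw [disjoint_left]
        intro x hx hy
        exact hij ((mem_filter.1 hx).2.symm.trans (mem_filter.1 hy).2)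
      union := eq_univ_of_forall fun x => by simp
      card_part := fun i => by
        have : (univ.filter fun x => Λ.block (σ⁻¹ x) = i) =
            univ.image fun j : Fin (Λ.comp i) => σ (Λ.blockEquiv ⟨i, j⟩) := by
          ext x
          simp only [mem_filter, mem_univ, true_and, mem_image]
          constructor
          · rintro rfl
            refine ⟨(Λ.blockEquiv.symm (σ⁻¹ x)).2, ?_⟩
            have : (⟨Λ.block (σ⁻¹ x), (Λ.blockEquiv.symm (σ⁻¹ x)).2⟩ : Σ i, Fin (Λ.comp i)) =
              Λ.blockEquiv.symm (σ⁻¹ x) := rfl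
            rw [this]
            simp
          · rintro ⟨j, rfl⟩
            simp [block_blockEquiv]
        rw [this, card_image_of_injective _ fun j k h => by simpa using h]
        simp }
  refine ⟨X, fun x => ?_⟩
  have : σ x ∈ X.part (Λ.block x) := by simp [X]
  exact (X.mem_part_iff _ _).1 this

end SetComposition

end Multipartition

/-! ### Multitableaux as pairs (set composition, tuple of standard tableaux) -/

namespace StdMultitableau

variable {Λ : Multipartition d r}

/-- A multitableau `T` is recovered from `t_X` and the tableaux `θ(Tᵢ)`. -/
theorem entry_eq (T : StdMultitableau Λ) (i : Fin d) (p : (Λ.shape i).cells) :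
    T.entry ⟨i, p⟩ =
      T.entrySets.perm (Λ.blockEquiv ⟨i, (T.component i).theta.entry p⟩) := by
  rw [Multipartition.SetComposition.perm_blockEquiv]
  let ι : Fin (Λ.shape i).card ≃o T.entrySet i := Fintype.orderIsoFinOfCardEq _
    ((Fintype.card_congr (T.component i).entry).symm.trans (Fintype.card_coe _))
  -- The enumeration defining $\theta$ and the one defining $t_X$ both list $E(T_i)$ in increasing
  -- order, so they coincide.
  have h1 : (fun j => (ι j : Fin r)) =
      (T.entrySets.part i).orderEmbOfFin (T.entrySets.card_part i) :=
    orderEmbOfFin_unique _ (fun j => (ι j).2) fun j k h => ι.strictMono h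
  have h2 : (T.component i).theta.entry p = ι.symm ((T.component i).entry p) := rfl
  rw [← h1, h2]
  exact (congrArg Subtype.val (ι.apply_symm_apply ((T.component i).entry p))).symm

/-- The decomposition of a multitableau in `entry_eq` is unique. -/
theorem perm_eq_and_theta_eq (T : StdMultitableau Λ) {π : Perm (Fin r)}
    {S : ∀ i, StdTableau (Λ.shape i) (Fin (Λ.shape i).card)}
    (hπ : ∀ i, StrictMono fun j : Fin (Λ.comp i) => π (Λ.blockEquiv ⟨i, j⟩))
    (h : ∀ i p, T.entry ⟨i, p⟩ = π (Λ.blockEquiv ⟨i, (S i).entry p⟩)) :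
    T.entrySets.perm = π ∧ (fun i => (T.component i).theta) = S := by
  have hperm : T.entrySets.perm = π := by
    ext1 x
    obtain ⟨⟨i, j⟩, rfl⟩ := Λ.blockEquiv.surjective x
    rw [Multipartition.SetComposition.perm_blockEquiv]
    -- On the $i$th block $\pi$ is increasing with values in $E(T_i)$, a set of exactly $c_i$
    -- elements; there is only one such map.
    refine (congrFun (orderEmbOfFin_unique (s := T.entrySets.part i) (T.entrySets.card_part i)
      (fun j => ?_) (hπ i)) j).symm
    obtain ⟨p, rfl⟩ := (S i).entry.surjective j
    rw [← h]
    exact mem_image_of_mem _ (mem_univ p)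
  refine ⟨hperm, funext fun i => ?_⟩
  ext p : 2
  have := (T.entry_eq i p).symm.trans (h i p)
  rw [hperm] at this
  simpa using this

/-- Since $t_X$ increases on each block, the uniqueness above applies with $\pi=t_X$, and a set
composition is determined by its permutation. -/
theorem entrySets_eq_and_theta_eq (T : StdMultitableau Λ) {X : Λ.SetComposition}
    {S : ∀ i, StdTableau (Λ.shape i) (Fin (Λ.shape i).card)}
    (h : ∀ i p, T.entry ⟨i, p⟩ = X.perm (Λ.blockEquiv ⟨i, (S i).entry p⟩)) :
    T.entrySets = X ∧ (fun i => (T.component i).theta) = S := by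
  obtain ⟨h1, h2⟩ := T.perm_eq_and_theta_eq X.strictMono_perm h
  refine ⟨Multipartition.SetComposition.eq_of_perm_inv_mul_mem ?_, h2⟩
  rw [h1, inv_mul_cancel]
  exact one_mem _

/-- The multitableau with given entry sets and given standardized components. -/
theorem exists_entrySets_eq (X : Λ.SetComposition)
    (S : ∀ i, StdTableau (Λ.shape i) (Fin (Λ.shape i).card)) :
    ∃ T : StdMultitableau Λ, T.entrySets = X ∧ (fun i => (T.component i).theta) = S := by
  let T : StdMultitableau Λ :=
    { entry := ((Equiv.sigmaCongrRight fun i => (S i).entry).trans Λ.blockEquiv).trans X.perm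
      std := fun i => ⟨fun p q h1 h2 => X.strictMono_perm i ((S i).std.1 p q h1 h2),
        fun p q h1 h2 => X.strictMono_perm i ((S i).std.2 p q h1 h2)⟩ }
  exact ⟨T, T.entrySets_eq_and_theta_eq fun i p => rfl⟩

theorem eq_of_entrySets_eq {T T' : StdMultitableau Λ} (h1 : T.entrySets = T'.entrySets)
    (h2 : (fun i => (T.component i).theta) = fun i => (T'.component i).theta) : T = T' := by
  ext ⟨i, p⟩ : 2
  rw [entry_eq, entry_eq, h1, show (T.component i).theta = (T'.component i).theta from
    congrFun h2 i]

/-- Inverse form of `entry_eq`, from which the component and the box of an entry are read. -/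
theorem entry_symm_perm (T : StdMultitableau Λ) (i : Fin d) (j : Fin (Λ.comp i)) :
    T.entry.symm (T.entrySets.perm (Λ.blockEquiv ⟨i, j⟩)) =
      ⟨i, (T.component i).theta.entry.symm j⟩ := by
  rw [Equiv.symm_apply_eq, entry_eq]
  simp

theorem index_eq_block (T : StdMultitableau Λ) (x : Fin r) :
    T.index x = Λ.block (T.entrySets.perm⁻¹ x) := by
  obtain ⟨y, rfl⟩ := T.entrySets.perm.surjective x
  obtain ⟨⟨i, j⟩, rfl⟩ := Λ.blockEquiv.surjective y
  simp [index, entry_symm_perm, Multipartition.block_blockEquiv]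

end StdMultitableau

end GdOneR

/-! ### Projections of an induced representation onto its cosets -/

namespace Representation

variable {k G V : Type*} [CommRing k] [Group G] [AddCommGroup V] [Module k V]

open Classical in
/-- The component of index `c` of a representation induced from a subgroup `S`, in the
decomposition `⨁ c ⊗ V` over the cosets `c S`. -/
noncomputable def IndV.cosetProj (S : Subgroup G) (ρ : Representation k S V) (c : G) :
    IndV S.subtype ρ →ₗ[k] V :=
  Coinvariants.lift _
    (TensorProduct.lift ((Finsupp.lift _ _ _ fun g : G =>
      -- In the coinvariants, $g\otimes v$ stands for $g^{-1}\otimes v$ of the usual tensor product.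
      -- It lies over $cS$ exactly when $gc\in S$, and then $g^{-1}=c\,(gc)^{-1}$.
      if h : g * c ∈ S then ρ (⟨g * c, h⟩ : S)⁻¹ else 0) ∘ₗ
      (MonoidAlgebra.coeffLinearEquiv k).toLinearMap))
    fun s => by
      refine TensorProduct.ext (MonoidAlgebra.lhom_ext' fun g => LinearMap.ext_ring ?_)
      ext v
      have hs : (s : G) * g * c ∈ S ↔ g * c ∈ S := by
        rw [mul_assoc]
        exact S.mul_mem_cancel_left s.2
      by_cases h : g * c ∈ S
      · have h' := hs.2 h
        -- This identity gives invariance under $(g,v)\mapsto(sg,sv)$.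
        have e : (⟨s * g * c, h'⟩ : S)⁻¹ * s = (⟨g * c, h⟩ : S)⁻¹ := by
          rw [inv_mul_eq_iff_eq_mul, eq_mul_inv_iff_mul_eq]
          ext
          simp [mul_assoc]
        simp [h, h', ← e]
      · simp [h, hs]

open Classical in
theorem IndV.cosetProj_mk (S : Subgroup G) (ρ : Representation k S V) (c g : G) (v : V) :
    IndV.cosetProj S ρ c (IndV.mk S.subtype ρ g v) =
      if h : g * c ∈ S then ρ (⟨g * c, h⟩ : S)⁻¹ v else 0 := by
  by_cases h : g * c ∈ S <;> simp [cosetProj, h]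

end Representation

/-! ### Exchanging consecutive entries of a multitableau -/

namespace GdOneR

open Equiv Finset

variable {d r : ℕ}

namespace StdMultitableau

variable {Λ : Multipartition d r} (T : StdMultitableau Λ)

/-- Exchanging consecutive integers reverses the order of that pair only. As the pair meets two
different components, $(x\ y)\,t_X$ still increases on every block: the new filling is standard, and
the uniqueness of the decomposition identifies its data. -/
theorem exists_swapVec_eq_single {x y : Fin r} (hxy : (x : ℕ) + 1 = y)
    (hne : T.index x ≠ T.index y) :
    ∃ T' : StdMultitableau Λ, T.swapVec x y = Finsupp.single T' 1 ∧
      T'.entrySets.perm = swap x y * T.entrySets.perm ∧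
      (fun i => (T'.component i).theta) = fun i => (T.component i).theta := by
  have hπ : ∀ i, StrictMono fun j : Fin (Λ.comp i) =>
      (swap x y * T.entrySets.perm) (Λ.blockEquiv ⟨i, j⟩) := by
    intro i j k hjk
    by_contra hc
    obtain ⟨rfl, rfl⟩ := swap_order hxy (T.entrySets.strictMono_perm i hjk) hc
    simp [index, entry_symm_perm] at hne
  have h : ∀ i p, (T.entry.trans (swap x y)) ⟨i, p⟩ =
      (swap x y * T.entrySets.perm) (Λ.blockEquiv ⟨i, (T.component i).theta.entry p⟩) := by
    intro i p
    rw [Equiv.trans_apply, entry_eq, Perm.mul_apply]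
  have hstd : ∀ i, IsStd (Λ.shape i) fun p => (T.entry.trans (swap x y)) ⟨i, p⟩ := by
    intro i
    simp only [h]
    exact ⟨fun p q h1 h2 => hπ i ((T.component i).theta.std.1 p q h1 h2),
      fun p q h1 h2 => hπ i ((T.component i).theta.std.2 p q h1 h2)⟩
  exact ⟨⟨_, hstd⟩, dif_pos hstd, perm_eq_and_theta_eq ⟨_, hstd⟩ hπ h⟩

/-- Consecutive entries of one component have consecutive positions in the block. -/
theorem exists_perm_eq {x y : Fin r} (hxy : (x : ℕ) + 1 = y) (he : T.index x = T.index y) :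
    ∃ (m : Fin d) (a b : Fin (Λ.comp m)), (a : ℕ) + 1 = b ∧
      T.entrySets.perm (Λ.blockEquiv ⟨m, a⟩) = x ∧ T.entrySets.perm (Λ.blockEquiv ⟨m, b⟩) = y := by
  obtain ⟨x', rfl⟩ := T.entrySets.perm.surjective x
  obtain ⟨y', rfl⟩ := T.entrySets.perm.surjective y
  obtain ⟨⟨m, a⟩, rfl⟩ := Λ.blockEquiv.surjective x'
  obtain ⟨⟨m', b⟩, rfl⟩ := Λ.blockEquiv.surjective y'
  obtain rfl : m = m' := by simpa [index, entry_symm_perm] using he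
  refine ⟨m, a, b, ?_, rfl, rfl⟩
  have hmono := T.entrySets.strictMono_perm m
  have hab : a < b := hmono.lt_iff_lt.1 (Fin.lt_def.2 (by omega))
  by_contra hne
  rw [Fin.lt_def] at hab
  -- If the positions were not consecutive, the entry at position $a+1$ would lie strictly between
  -- $x$ and $x+1$.
  let c : Fin (Λ.comp m) := ⟨a + 1, by omega⟩
  have h1 := hmono (show a < c from Fin.lt_def.2 (by simp [c]))
  have h2 := hmono (show c < b from Fin.lt_def.2 (by simp only [c]; omega))
  rw [Fin.lt_def] at h1 h2
  dsimp only at h1 h2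
  omega

end StdMultitableau

/-! ### A basis of the James–Kerber module and the action of the inertia group -/

namespace Multipartition

variable (Λ : Multipartition d r)

theorem jamesKerberRep_indVec (g h : Grp d r) (v : Λ.TensorSpace) :
    Λ.jamesKerberRep g (Λ.indVec h v) = Λ.indVec (g * h) v := by
  rw [indVec, jamesKerberRep, Representation.ind_mk, indVec, mul_inv_rev]

/-- This balancing relation of the tensor product over $\mathbb C[G_c]$ is what passing to
coinvariants imposes. -/
theorem indVec_mul (g : Grp d r) (h : Λ.inertia) (v : Λ.TensorSpace) :
    Λ.indVec (g * h) v = Λ.indVec g (Λ.tensorRep h v) := by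
  have := Representation.Coinvariants.mk_inv_tmul
    (ρ := (Representation.leftRegular ℂ (Grp d r)).comp Λ.inertia.subtype) (τ := Λ.tensorRep)
    (MonoidAlgebra.single g⁻¹ 1) v h
  refine Eq.trans ?_ this
  simp [indVec]

/-- The basis of `V_λ` formed by the vectors `tensorVec S`. -/
noncomputable def tensorBasis :
    Module.Basis (∀ i, StdTableau (Λ.shape i) (Fin (Λ.shape i).card)) ℂ Λ.TensorSpace :=
  Basis.piTensorProduct fun _ => Finsupp.basisSingleOne

theorem tensorBasis_apply (S : ∀ i, StdTableau (Λ.shape i) (Fin (Λ.shape i).card)) :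
    Λ.tensorBasis S = Λ.tensorVec S := by
  refine (Basis.piTensorProduct_apply _ S).trans ?_
  simp [tensorVec]

/-- The coefficient of `t_X ⊗ v_{S₀} ⊗ ⋯ ⊗ v_{S_{d-1}}`. -/
noncomputable def jkCoord (X : Λ.SetComposition)
    (S : ∀ i, StdTableau (Λ.shape i) (Fin (Λ.shape i).card)) : Λ.IndSpace →ₗ[ℂ] ℂ :=
  Λ.tensorBasis.coord S ∘ₗ
    Representation.IndV.cosetProj Λ.inertia Λ.tensorRep (SemidirectProduct.inr X.perm)

theorem inr_mem_inertia_iff {σ : Perm (Fin r)} :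
    (SemidirectProduct.inr σ : Grp d r) ∈ Λ.inertia ↔ σ ∈ Λ.youngSubgroup := Iff.rfl

open Classical in
-- Distinct $t_X$ lie in distinct cosets, so the projection kills all other summands; on its own
-- coset it leaves a coordinate for the tensor basis. This duality yields linear independence.
theorem jkCoord_jkVec (X Y : Λ.SetComposition)
    (S S' : ∀ i, StdTableau (Λ.shape i) (Fin (Λ.shape i).card)) :
    Λ.jkCoord X S (Λ.jkVec Y S') = if Y = X ∧ S' = S then 1 else 0 := by
  have h1 : Λ.jkCoord X S (Λ.jkVec Y S') = Λ.tensorBasis.coord S _ :=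
    congrArg (Λ.tensorBasis.coord S) (Representation.IndV.cosetProj_mk Λ.inertia Λ.tensorRep _ _ _)
  rw [h1]
  by_cases h : Y = X
  · subst h
    have h2 : (SemidirectProduct.inr Y.perm : Grp d r)⁻¹ * SemidirectProduct.inr Y.perm = 1 :=
      inv_mul_cancel _
    have h3 : (⟨(SemidirectProduct.inr Y.perm : Grp d r)⁻¹ * SemidirectProduct.inr Y.perm,
        h2 ▸ one_mem _⟩ : Λ.inertia)⁻¹ = 1 := by
      rw [inv_eq_one]
      exact Subtype.ext h2
    rw [dif_pos (h2 ▸ one_mem _), h3, map_one, Module.End.one_apply, ← tensorBasis_apply]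
    simp [Finsupp.single_apply]
  · rw [dif_neg, map_zero, if_neg fun h' => h h'.1]
    rw [← map_inv, ← map_mul, inr_mem_inertia_iff]
    exact fun h' => h (SetComposition.eq_of_perm_inv_mul_mem h')

/-- The vectors `jkVec X S` span the James-Kerber representation. -/
theorem eq_top_of_jkVec_mem (U : Submodule ℂ Λ.IndSpace) (h : ∀ X S, Λ.jkVec X S ∈ U) :
    U = ⊤ := by
  have h1 : ∀ (X : Λ.SetComposition) v, Λ.indVec (SemidirectProduct.inr X.perm) v ∈ U := by
    intro X v
    have h : ⊤ ≤ U.comap (Representation.IndV.mk Λ.inertia.subtype Λ.tensorRep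
        (SemidirectProduct.inr X.perm)⁻¹) := by
      rw [← Λ.tensorBasis.span_eq, Submodule.span_le]
      rintro _ ⟨S, rfl⟩
      rw [tensorBasis_apply]
      exact h X S
    exact h (Submodule.mem_top (x := v))
  have h2 : ∀ g v, Λ.indVec g v ∈ U := by
    intro g v
    obtain ⟨X, hX⟩ := SetComposition.exists_perm_inv_mul_mem Λ g.right
    -- Membership in $G_c$ concerns the permutation component only, so it suffices to represent the
    -- coset of `g.right`.
    have hX' : (SemidirectProduct.inr X.perm)⁻¹ * g ∈ Λ.inertia := hX
    have : g = (SemidirectProduct.inr X.perm : Grp d r) * (⟨_, hX'⟩ : Λ.inertia) :=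
      (mul_inv_cancel_left _ _).symm
    rw [this, indVec_mul]
    exact h1 _ _
  -- A linear map out of the induced module is determined by its values on the vectors `indVec g v`,
  -- and the quotient map by `U` kills them.
  have h3 : U.mkQ = 0 := by
    refine Representation.IndV.hom_ext _ _ fun g => LinearMap.ext fun v => ?_
    have := h2 g⁻¹ v
    rw [indVec, inv_inv] at this
    exact (Submodule.Quotient.mk_eq_zero _).2 this
  rw [← U.ker_mkQ, h3, LinearMap.ker_zero]

/-- The vector `w₀ ⊗ ⋯ ⊗ w_{d-1}` of `V_λ`. -/
noncomputable def tensorMk : MultilinearMap ℂ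
    (fun i => StdTableau (Λ.shape i) (Fin (Λ.shape i).card) →₀ ℂ) Λ.TensorSpace :=
  PiTensorProduct.tprod ℂ

theorem tensorRep_tensorMk (h : Λ.inertia)
    (w : ∀ i, StdTableau (Λ.shape i) (Fin (Λ.shape i).card) →₀ ℂ) :
    Λ.tensorRep h (Λ.tensorMk w) = Λ.inertiaChar h •
      Λ.tensorMk fun i => youngRep (Λ.shape i) (Λ.localPerm i (Λ.inertiaProj h)) (w i) :=
  congrArg (Λ.inertiaChar h • ·) (PiTensorProduct.map_tprod
    (fun i => youngRep (Λ.shape i) (Λ.localPerm i (Λ.inertiaProj h))) w)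

theorem swap_blockEquiv_mem (m : Fin d) (a b : Fin (Λ.comp m)) :
    swap (Λ.blockEquiv ⟨m, a⟩) (Λ.blockEquiv ⟨m, b⟩) ∈ Λ.youngSubgroup := by
  intro x
  rw [swap_apply_def]
  split_ifs with h1 h2
  · rw [h1, block_blockEquiv, block_blockEquiv]
  · rw [h2, block_blockEquiv, block_blockEquiv]
  · rfl

theorem localPerm_swap_self (m : Fin d) (a b : Fin (Λ.comp m)) :
    Λ.localPerm m ⟨_, Λ.swap_blockEquiv_mem m a b⟩ = swap a b := by
  ext1 j
  refine (Λ.localFun_eq_iff _ _ _ _).2 ?_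
  simp only [swap_apply_def, EmbeddingLike.apply_eq_iff_eq, Sigma.mk.injEq, heq_eq_eq, true_and]
  split_ifs <;> rfl

theorem localPerm_swap_of_ne {m i : Fin d} (hi : i ≠ m) (a b : Fin (Λ.comp m)) :
    Λ.localPerm i ⟨_, Λ.swap_blockEquiv_mem m a b⟩ = 1 := by
  ext1 j
  refine (Λ.localFun_eq_iff _ _ _ _).2 (swap_apply_of_ne_of_ne ?_ ?_) <;> simp [hi]

/-- The transposition fixes every other block pointwise and has trivial component in $\mathcal
U_d^r$, so neither the other factors nor the character contribute. -/
theorem tensorRep_swap (m : Fin d) (a b : Fin (Λ.comp m))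
    (w : ∀ i, StdTableau (Λ.shape i) (Fin (Λ.shape i).card) →₀ ℂ) :
    Λ.tensorRep ⟨SemidirectProduct.inr (swap (Λ.blockEquiv ⟨m, a⟩) (Λ.blockEquiv ⟨m, b⟩)),
      Λ.swap_blockEquiv_mem m a b⟩ (Λ.tensorMk w) =
        Λ.tensorMk (Function.update w m (youngRep (Λ.shape m) (swap a b) (w m))) := by
  rw [tensorRep_tensorMk]
  have h1 : Λ.inertiaChar ⟨SemidirectProduct.inr
      (swap (Λ.blockEquiv ⟨m, a⟩) (Λ.blockEquiv ⟨m, b⟩)), Λ.swap_blockEquiv_mem m a b⟩ = 1 := by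
    simp [inertiaChar]
  rw [h1, one_smul]
  congr 1
  funext i
  have h2 : Λ.inertiaProj ⟨SemidirectProduct.inr
      (swap (Λ.blockEquiv ⟨m, a⟩) (Λ.blockEquiv ⟨m, b⟩)), Λ.swap_blockEquiv_mem m a b⟩ =
      ⟨_, Λ.swap_blockEquiv_mem m a b⟩ := rfl
  rw [h2]
  by_cases hi : i = m
  · subst hi
    rw [localPerm_swap_self, Function.update_self]
  · rw [localPerm_swap_of_ne Λ hi, map_one, Function.update_of_ne hi, Module.End.one_apply]

theorem tensorRep_mulSingle (x : Fin r) (ζ : rootsOfUnity d ℂ)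
    (hx : (SemidirectProduct.inl (Pi.mulSingle x ζ) : Grp d r) ∈ Λ.inertia)
    (v : Λ.TensorSpace) :
    Λ.tensorRep ⟨SemidirectProduct.inl (Pi.mulSingle x ζ), hx⟩ v =
      ((ζ : ℂˣ) : ℂ) ^ (Λ.block x : ℕ) • v := by
  have h1 : Λ.inertiaChar ⟨SemidirectProduct.inl (Pi.mulSingle x ζ), hx⟩ =
      ((ζ : ℂˣ) : ℂ) ^ (Λ.block x : ℕ) := by
    change ∏ y, ((Pi.mulSingle (M := fun _ => rootsOfUnity d ℂ) x ζ y : ℂˣ) : ℂ) ^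
      (Λ.block y : ℕ) = _
    rw [Finset.prod_eq_single x]
    · simp
    · intro y _ hy
      simp [Pi.mulSingle_eq_of_ne hy]
    · simp
  have h2 : Λ.inertiaProj ⟨SemidirectProduct.inl (Pi.mulSingle x ζ), hx⟩ = 1 := rfl
  suffices Λ.tensorRep ⟨SemidirectProduct.inl (Pi.mulSingle x ζ), hx⟩ =
      ((ζ : ℂˣ) : ℂ) ^ (Λ.block x : ℕ) • LinearMap.id from LinearMap.congr_fun this v
  refine Λ.tensorBasis.ext fun S => ?_
  rw [tensorBasis_apply]
  refine (Λ.tensorRep_tensorMk _ _).trans ?_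
  rw [h1, h2]
  simp only [map_one, Module.End.one_apply]
  rfl

end Multipartition

/-! ### Generation of $G(d,1,r)$ by $t$ and the simple transpositions -/

section Generators

theorem mulAutArrow_mulSingle (σ : Perm (Fin r)) (x : Fin r) (w : rootsOfUnity d ℂ) :
    mulAutArrow σ (Pi.mulSingle x w : Fin r → rootsOfUnity d ℂ) = Pi.mulSingle (σ x) w := by
  funext y
  change (Pi.mulSingle x w : Fin r → rootsOfUnity d ℂ) (σ⁻¹ y) = _
  simp only [Pi.mulSingle_apply, Perm.inv_eq_iff_eq]

theorem inr_mul_inl_mulSingle (σ : Perm (Fin r)) (x : Fin r) (w : rootsOfUnity d ℂ) :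
    (SemidirectProduct.inr σ * SemidirectProduct.inl (Pi.mulSingle x w) : Grp d r) =
      SemidirectProduct.inl (Pi.mulSingle (σ x) w) * SemidirectProduct.inr σ := by
  rw [← mulAutArrow_mulSingle, SemidirectProduct.inl_aut, map_inv, inv_mul_cancel_right]

/-- Simple transpositions generate $\mathfrak S_r$; conjugating $t$ moves $\zeta$ to any coordinate,
its powers give all of $\mathcal U_d$ there, and products over the coordinates give $\mathcal
U_d^r$. -/
theorem eq_top_of_tGen_mem {hr : 0 < r} {ζ : rootsOfUnity d ℂ} (hζ : Subgroup.zpowers ζ = ⊤)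
    {K : Subgroup (Grp d r)} (ht : tGen hr ζ ∈ K)
    (hs : ∀ x y : Fin r, (x : ℕ) + 1 = y → SemidirectProduct.inr (swap x y) ∈ K) : K = ⊤ := by
  have h1 : ∀ σ : Perm (Fin r), (SemidirectProduct.inr σ : Grp d r) ∈ K := by
    intro σ
    obtain ⟨n, rfl⟩ : ∃ n, r = n + 1 := ⟨r - 1, by omega⟩
    have : (K.comap SemidirectProduct.inr).toSubmonoid = ⊤ := by
      rw [← top_le_iff, ← Perm.mclosure_swap_castSucc_succ, Submonoid.closure_le]
      rintro _ ⟨i, rfl⟩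
      exact hs _ _ (by simp)
    have h : σ ∈ (K.comap SemidirectProduct.inr).toSubmonoid := this ▸ Submonoid.mem_top σ
    exact h
  have h2 : ∀ x (w : rootsOfUnity d ℂ), SemidirectProduct.inl (Pi.mulSingle x w) ∈ K := by
    intro x w
    obtain ⟨k, rfl⟩ := Subgroup.mem_zpowers_iff.1 (hζ ▸ Subgroup.mem_top w)
    rw [Pi.mulSingle_zpow, map_zpow]
    refine K.zpow_mem ?_ k
    have : mulAutArrow (swap ⟨0, hr⟩ x) (Pi.mulSingle ⟨0, hr⟩ ζ) =
        (Pi.mulSingle x ζ : Fin r → rootsOfUnity d ℂ) := by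
      rw [mulAutArrow_mulSingle, swap_apply_left]
    rw [← this, SemidirectProduct.inl_aut]
    exact K.mul_mem (K.mul_mem (h1 _) ht) (h1 _)
  have h3 : ∀ z, SemidirectProduct.inl z ∈ K := by
    intro z
    have : z ∈ K.comap SemidirectProduct.inl := by
      rw [← Finset.univ_prod_mulSingle z]
      exact Subgroup.prod_mem _ fun x _ => h2 x _
    exact this
  refine eq_top_iff.2 fun g _ => ?_
  rw [← SemidirectProduct.inl_left_mul_inr_right g]
  exact K.mul_mem (h3 _) (h1 _)

end Generators

end GdOneR

/-! ### The linear isomorphism and the action of the generators -/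

namespace GdOneR

open Equiv Finset

variable {d r : ℕ}

theorem isStd_comp_iff {μ : YoungDiagram} {α β : Type*} [LinearOrder α] [LinearOrder β]
    {f : α → β} (hf : StrictMono f) (e : μ.cells → α) :
    IsStd μ (fun p => f (e p)) ↔ IsStd μ e := by
  simp only [IsStd, hf.lt_iff_lt]

namespace StdMultitableau

variable {Λ : Multipartition d r} (T : StdMultitableau Λ)

/-- Conjugation by $t_X$ turns an exchange of entries into an exchange of positions in the block; so
$X$ stays fixed and only $\theta(T_m)$ changes. -/
theorem trans_swap_entry {m : Fin d} (a b : Fin (Λ.comp m)) (i : Fin d) (p : (Λ.shape i).cells) :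
    (T.entry.trans (swap (T.entrySets.perm (Λ.blockEquiv ⟨m, a⟩))
      (T.entrySets.perm (Λ.blockEquiv ⟨m, b⟩)))) ⟨i, p⟩ =
    T.entrySets.perm (Λ.blockEquiv ⟨i, Function.update (fun i => (T.component i).theta.entry) m
      ((T.component m).theta.entry.trans (swap a b)) i p⟩) := by
  rw [Equiv.trans_apply, entry_eq, swap_apply_def]
  simp only [EmbeddingLike.apply_eq_iff_eq]
  by_cases hi : i = m
  · subst hi
    simp only [Sigma.mk.injEq, heq_eq_eq, true_and, Function.update_self, Equiv.trans_apply,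
      swap_apply_def]
    split_ifs <;> rfl
  · simp [hi]

theorem axialDist_perm {m : Fin d} (a b : Fin (Λ.comp m)) :
    T.axialDist (T.entrySets.perm (Λ.blockEquiv ⟨m, a⟩))
      (T.entrySets.perm (Λ.blockEquiv ⟨m, b⟩)) = (T.component m).theta.axialDist a b := by
  rw [axialDist, entry_symm_perm, entry_symm_perm, StdTableau.axialDist]

end StdMultitableau

namespace Multipartition

variable (Λ : Multipartition d r)

/-- The linear map from the Marin-Michel model to the James-Kerber model. -/
noncomputable def toJamesKerber : (StdMultitableau Λ →₀ ℂ) →ₗ[ℂ] Λ.IndSpace :=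
  Finsupp.linearCombination ℂ fun T => Λ.jkVec T.entrySets fun i => (T.component i).theta

theorem toJamesKerber_single (T : StdMultitableau Λ) :
    Λ.toJamesKerber (Finsupp.single T 1) =
      Λ.jkVec T.entrySets fun i => (T.component i).theta := by
  simp [toJamesKerber]

/-- Composing with the dual functional of the pair attached to $T$ recovers the coefficient of $T$,
because the pair determines $T$. Conversely every pair comes from a multitableau, and the
corresponding vectors span. -/
theorem toJamesKerber_bijective : Function.Bijective Λ.toJamesKerber := by
  classical
  constructor
  · refine (injective_iff_map_eq_zero _).2 fun v hv => ?_
    ext T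
    have h : Λ.jkCoord T.entrySets (fun i => (T.component i).theta) ∘ₗ Λ.toJamesKerber =
        Finsupp.lapply T := by
      refine Finsupp.lhom_ext' fun T' => LinearMap.ext_ring ?_
      simp only [LinearMap.comp_apply, Finsupp.lsingle_apply, toJamesKerber_single, jkCoord_jkVec,
        Finsupp.lapply_apply, Finsupp.single_apply]
      congr 1
      refine propext ⟨fun h => StdMultitableau.eq_of_entrySets_eq h.1 h.2, ?_⟩
      rintro rfl
      exact ⟨rfl, rfl⟩
    have := LinearMap.congr_fun h v
    rw [LinearMap.comp_apply, hv, map_zero] at this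
    exact this.symm
  · refine LinearMap.range_eq_top.1 (Λ.eq_top_of_jkVec_mem _ fun X S => ?_)
    obtain ⟨T, rfl, rfl⟩ := StdMultitableau.exists_entrySets_eq X S
    exact ⟨_, Λ.toJamesKerber_single T⟩

theorem jkVec_eq (X : Λ.SetComposition)
    (S : ∀ i, StdTableau (Λ.shape i) (Fin (Λ.shape i).card)) :
    Λ.jkVec X S = Λ.indVec (SemidirectProduct.inr X.perm)
      (Λ.tensorMk fun i => Finsupp.single (S i) 1) := rfl

theorem indVec_add (g : Grp d r) (v w : Λ.TensorSpace) :
    Λ.indVec g (v + w) = Λ.indVec g v + Λ.indVec g w := map_add _ v w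

theorem indVec_smul (g : Grp d r) (c : ℂ) (v : Λ.TensorSpace) :
    Λ.indVec g (c • v) = c • Λ.indVec g v := map_smul _ c v

/-- As $t_X$ increases on each block, the exchanged multitableau is standard exactly when the
exchanged $\theta(T_m)$ is; hence the convention of reading nonstandard fillings as $0$ is
respected. The `Function.update` form prepares the use of multilinearity. -/
theorem toJamesKerber_swapVec (T : StdMultitableau Λ) {m : Fin d} (a b : Fin (Λ.comp m)) :
    Λ.toJamesKerber (T.swapVec (T.entrySets.perm (Λ.blockEquiv ⟨m, a⟩))
      (T.entrySets.perm (Λ.blockEquiv ⟨m, b⟩))) =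
    Λ.indVec (SemidirectProduct.inr T.entrySets.perm) (Λ.tensorMk (Function.update
      (fun i => Finsupp.single (T.component i).theta 1) m
        ((T.component m).theta.swapVec a b))) := by
  have he := T.trans_swap_entry a b
  by_cases h : IsStd (Λ.shape m) ((T.component m).theta.entry.trans (swap a b))
  · let S' : ∀ i, StdTableau (Λ.shape i) (Fin (Λ.shape i).card) :=
      Function.update (fun i => (T.component i).theta) m ⟨_, h⟩
    have hS : ∀ i, Function.update (fun i => (T.component i).theta.entry) m
        ((T.component m).theta.entry.trans (swap a b)) i = (S' i).entry := by
      intro i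
      by_cases hi : i = m
      · subst hi
        simp [S']
      · simp [S', hi]
    have hstd : ∀ i, IsStd (Λ.shape i) fun p => (T.entry.trans (swap
        (T.entrySets.perm (Λ.blockEquiv ⟨m, a⟩)) (T.entrySets.perm (Λ.blockEquiv ⟨m, b⟩))))
          ⟨i, p⟩ := by
      intro i
      simp only [he, hS]
      exact (isStd_comp_iff (T.entrySets.strictMono_perm i) _).2 (S' i).std
    obtain ⟨h1, h2⟩ := StdMultitableau.entrySets_eq_and_theta_eq ⟨_, hstd⟩ (X := T.entrySets)
      (S := S') fun i p => (he i p).trans (by rw [hS])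
    rw [StdMultitableau.swapVec, dif_pos hstd, toJamesKerber_single, h1, h2, jkVec_eq,
      StdTableau.swapVec, dif_pos h]
    congr 2
    funext i
    by_cases hi : i = m
    · subst hi
      simp [S']
    · simp [S', hi]
  · have hstd : ¬ ∀ i, IsStd (Λ.shape i) fun p => (T.entry.trans (swap
        (T.entrySets.perm (Λ.blockEquiv ⟨m, a⟩)) (T.entrySets.perm (Λ.blockEquiv ⟨m, b⟩))))
          ⟨i, p⟩ := by
      intro hs
      have := hs m
      simp only [he, Function.update_self] at this
      exact h ((isStd_comp_iff (T.entrySets.strictMono_perm m) _).1 this)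
    rw [StdMultitableau.swapVec, dif_neg hstd, StdTableau.swapVec, dif_neg h,
      MultilinearMap.map_update_zero, map_zero]
    exact (map_zero (Representation.IndV.mk Λ.inertia.subtype Λ.tensorRep _)).symm

/-- Moving $t$ across $t_X$ gives an element of $G_c$ with $\zeta$ in the coordinate that $t_X$
sends to the first letter; the block of that coordinate is the component of $T$ containing the first
letter. -/
theorem jamesKerberRep_tGen (hr : 0 < r) (ζ : rootsOfUnity d ℂ) (T : StdMultitableau Λ) :
    Λ.jamesKerberRep (tGen hr ζ) (Λ.toJamesKerber (Finsupp.single T 1)) =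
      ((ζ : ℂˣ) : ℂ) ^ (T.index ⟨0, hr⟩ : ℕ) • Λ.toJamesKerber (Finsupp.single T 1) := by
  have hmem : ∀ z, (SemidirectProduct.inl z : Grp d r) ∈ Λ.inertia := fun z =>
    Λ.youngSubgroup.one_mem
  have hconj : tGen hr ζ * SemidirectProduct.inr T.entrySets.perm =
      (SemidirectProduct.inr T.entrySets.perm : Grp d r) *
        ((⟨SemidirectProduct.inl (Pi.mulSingle (T.entrySets.perm⁻¹ ⟨0, hr⟩) ζ), hmem _⟩ :
          Λ.inertia) : Grp d r) := by
    rw [inr_mul_inl_mulSingle, ← Perm.mul_apply, mul_inv_cancel, Perm.one_apply, tGen]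
  rw [toJamesKerber_single, jkVec, jamesKerberRep_indVec, hconj, indVec_mul, tensorRep_mulSingle,
    indVec_smul, T.index_eq_block]

theorem jamesKerberRep_swap_of_ne (T : StdMultitableau Λ) {x y : Fin r} (hxy : (x : ℕ) + 1 = y)
    (hne : T.index x ≠ T.index y) :
    Λ.jamesKerberRep (SemidirectProduct.inr (swap x y)) (Λ.toJamesKerber (Finsupp.single T 1)) =
      Λ.toJamesKerber (T.swapVec x y) := by
  obtain ⟨T', h1, h2, h3⟩ := T.exists_swapVec_eq_single hxy hne
  rw [h1, toJamesKerber_single, toJamesKerber_single, jkVec, jkVec, jamesKerberRep_indVec, h2, h3,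
    map_mul]

/-- Here $(x\ y)\,t_X=t_X\,s$ with $s$ a simple transposition inside block $m$. Young's formula in
the $m$th factor expands by multilinearity, and $\theta$ preserves axial distances because it leaves
the boxes in place. -/
theorem jamesKerberRep_swap_of_eq (T : StdMultitableau Λ) {x y : Fin r} (hxy : (x : ℕ) + 1 = y)
    (he : T.index x = T.index y) :
    Λ.jamesKerberRep (SemidirectProduct.inr (swap x y)) (Λ.toJamesKerber (Finsupp.single T 1)) =
      (1 / (T.axialDist x y : ℂ)) • Λ.toJamesKerber (Finsupp.single T 1) +
        (1 + 1 / (T.axialDist x y : ℂ)) • Λ.toJamesKerber (T.swapVec x y) := by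
  obtain ⟨m, a, b, hab, rfl, rfl⟩ := T.exists_perm_eq hxy he
  have hconj : (SemidirectProduct.inr (swap (T.entrySets.perm (Λ.blockEquiv ⟨m, a⟩))
      (T.entrySets.perm (Λ.blockEquiv ⟨m, b⟩))) : Grp d r) *
        SemidirectProduct.inr T.entrySets.perm = SemidirectProduct.inr T.entrySets.perm *
      ((⟨SemidirectProduct.inr (swap (Λ.blockEquiv ⟨m, a⟩) (Λ.blockEquiv ⟨m, b⟩)),
        Λ.swap_blockEquiv_mem m a b⟩ : Λ.inertia) : Grp d r) := by
    rw [← map_mul, ← map_mul, mul_swap_eq_swap_mul]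
  rw [toJamesKerber_swapVec, toJamesKerber_single, jkVec_eq, jamesKerberRep_indVec, hconj,
    indVec_mul, tensorRep_swap, youngRep_isSeminormal _ _ _ _ hab, T.axialDist_perm,
    MultilinearMap.map_update_add, MultilinearMap.map_update_smul,
    MultilinearMap.map_update_smul, indVec_add, indVec_smul, indVec_smul]
  congr 4
  -- In the diagonal term the update writes back the factor already present.
  exact Function.update_eq_self _ _

end Multipartition

/-! ### Uniqueness, transport of structure, and conclusion -/

theorem isMarinMichel_unique {hr : 0 < r} {ζ : rootsOfUnity d ℂ} (hζ : Subgroup.zpowers ζ = ⊤)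
    {Λ : Multipartition d r} {ρ₁ ρ₂ : Representation ℂ (Grp d r) (StdMultitableau Λ →₀ ℂ)}
    (h₁ : IsMarinMichel hr ζ Λ ρ₁) (h₂ : IsMarinMichel hr ζ Λ ρ₂) : ρ₁ = ρ₂ := by
  -- The elements on which both actions agree form a subgroup, and it contains the generators.
  have key : MonoidHom.eqLocus ρ₁ ρ₂ = ⊤ := by
    refine eq_top_of_tGen_mem (hr := hr) hζ ?_ fun x y hxy => ?_
    · refine Finsupp.lhom_ext' fun T => LinearMap.ext_ring ?_
      exact (h₁.apply_t T).trans (h₂.apply_t T).symm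
    · refine Finsupp.lhom_ext' fun T => LinearMap.ext_ring ?_
      by_cases h : T.index x = T.index y
      · exact (h₁.apply_s_of_eq T x y hxy h).trans (h₂.apply_s_of_eq T x y hxy h).symm
      · exact (h₁.apply_s_of_ne T x y hxy h).trans (h₂.apply_s_of_ne T x y hxy h).symm
  exact MonoidHom.ext fun g => key.ge (Subgroup.mem_top g)

/-- The James-Kerber representation, transported to the space of the Marin-Michel model, satisfies
the formulas of Marin and Michel. -/
theorem exists_isMarinMichel (hr : 0 < r) (ζ : rootsOfUnity d ℂ) (Λ : Multipartition d r) :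
    ∃ ρ' : Representation ℂ (Grp d r) (StdMultitableau Λ →₀ ℂ), IsMarinMichel hr ζ Λ ρ' ∧
      ∀ g v, Λ.toJamesKerber (ρ' g v) = Λ.jamesKerberRep g (Λ.toJamesKerber v) := by
  let F := LinearEquiv.ofBijective Λ.toJamesKerber Λ.toJamesKerber_bijective
  let ρ' : Representation ℂ (Grp d r) (StdMultitableau Λ →₀ ℂ) :=
    { toFun := fun g => F.symm.toLinearMap ∘ₗ Λ.jamesKerberRep g ∘ₗ F.toLinearMap
      map_one' := LinearMap.ext fun v => by simp
      map_mul' := fun g h => by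
        refine LinearMap.ext fun v => ?_
        simp }
  have hρ : ∀ g v, Λ.toJamesKerber (ρ' g v) = Λ.jamesKerberRep g (Λ.toJamesKerber v) :=
    fun g v => F.apply_symm_apply _
  -- Each formula is checked after applying the injective intertwiner, where it becomes a
  -- computation in the James–Kerber module.
  refine ⟨ρ', ⟨fun T => ?_, fun T x y hxy h => ?_, fun T x y hxy h => ?_⟩, hρ⟩ <;>
    apply Λ.toJamesKerber_bijective.injective <;> rw [hρ]
  · rw [Λ.jamesKerberRep_tGen, map_smul]
  · exact Λ.jamesKerberRep_swap_of_ne T hxy h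
  · rw [Λ.jamesKerberRep_swap_of_eq T hxy h, map_add, map_smul, map_smul]

end GdOneR

theorem proposition2 {d r : ℕ} (hd : 0 < d) (hr : 0 < r) (ζ : rootsOfUnity d ℂ)
    (hζ : Subgroup.zpowers ζ = ⊤) (Λ : Multipartition d r) :
    (∃! ρ' : Representation ℂ (Grp d r) (StdMultitableau Λ →₀ ℂ), IsMarinMichel hr ζ Λ ρ') ∧
    ∀ ρ' : Representation ℂ (Grp d r) (StdMultitableau Λ →₀ ℂ), IsMarinMichel hr ζ Λ ρ' →
      ∃ f : Representation.Equiv ρ' Λ.jamesKerberRep, ∀ T : StdMultitableau Λ,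
        f (Finsupp.single T 1) = Λ.jkVec T.entrySets (fun i => (T.component i).theta) := by
  obtain ⟨ρ₀, h₀, hF⟩ := exists_isMarinMichel hr ζ Λ
  refine ⟨⟨ρ₀, h₀, fun ρ' h => isMarinMichel_unique hζ h h₀⟩, fun ρ' h => ?_⟩
  -- Any structure with these formulas is the transported one, for which equivariance holds by
  -- construction.
  obtain rfl := isMarinMichel_unique hζ h h₀
  exact ⟨Representation.Equiv.mk
    (LinearEquiv.ofBijective Λ.toJamesKerber Λ.toJamesKerber_bijective)
    fun g => LinearMap.ext fun v => hF g v, fun T => Λ.toJamesKerber_single T⟩
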